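/- **Setting.** Let $(\mathcal N,\mathcal E)$ be a finite undirected graph, $\mathcal N_i$ the neighbours of node $i$, $\tilde{\mathcal N}_i=\mathcal N_i\cup\{i\}$, $n_i=|\tilde{\mathcal N}_i|$. Node $i$ chooses allocations $\boldsymbol x_i=(x_i(j))_{j\in\tilde{\mathcal N}_i}$ from a closed convex set $\mathcal X_i\subseteq\mathbb R_{+}^{\tilde{\mathcal N}_i}$ that lies in a ball of radius $R_i>0$ and contains a ball of radius $r_i>0$. In round $t$ it has a demand $l_{i,t}\ge l_{\min}>0$ and a random generation $d_{i,t}\ge 0$. For an allocation profile put $$\bar f_{j,t}=\min\Big\{\tfrac{1}{l_{j,t}}\sum_{k\in\tilde{\mathcal N}_j}x_{k}(j),1\Big\},\qquad f_{i,t}=1-\frac1{n_i}\sum_{j\in\tilde{\mathcal N}_i}\bar f_{j,t},\qquad g_{i,t}(\boldsymbol x_i)=\sum_{j\in\tilde{\mathcal N}_i}x_i(j)-d_{i,t}.$$ Assume that on the action sets $|f_{i,t}|\le F_i$ and $|g_{i,t}|\le G_i$, where $F_i,G_i>0$. Let $L=1/l_{\min}$ and $\tilde L_i=3L+LR_i/r_i$.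 For a comparator sequence $\boldsymbol v_{i,1},\dots,\boldsymbol v_{i,T}\in\mathcal X_i$ let $P_T^i=\sum_{t=2}^T\|\boldsymbol v_{i,t}-\boldsymbol v_{i,t-1}\|$. **Algorithm (MA-NSDRS), run by all nodes simultaneously, horizon $T\ge1$.** Node $i$ uses $K=\lceil\frac12\log_2(1+T)\rceil+1$ experts, a learning rate $\epsilon_i$, and $$\eta_{i,t}^k=2^{k-1}\sqrt{\tfrac{2R_i^3}{2|\mathcal N_i|F_i\tilde L_i}}\;t^{-3/4},\quad \delta_{i,t}=\Big(\tfrac{|\mathcal N_i|F_i}{\tilde L_i}\Big)^{1/2}\Big(\tfrac{R_i^2/2+R_ip_i}{t}\Big)^{1/4},\quad \xi_{i,t}=\tfrac{\delta_{i,t}}{r_i},\quad \beta_{i,t}=\tfrac1{G_it^{1/2}},\quad\gamma_{i,t}=\tfrac1{G_i^2t^{1/2}},$$ where $p_i\in[0,P_T^i]$ is any number (for instance $p_i=P^i_T$, or $p_i=0$, in which case the algorithm does not use $P^i_T$ at all). Start with $\boldsymbol z_{i,1}^k=\boldsymbol z_{i,1}\in(1-\xi_{i,1})\mathcal X_i$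 for all $k$, $\omega_{i,1}^k=\frac{K+1}{K}\frac1{k(k+1)}$ and $q_{i,1}=0$. In round $t$: * $\boldsymbol z_{i,t}=\sum_{k=1}^K\omega_{i,t}^k\boldsymbol z_{i,t}^k$ and $\boldsymbol x_{i,t}=\boldsymbol z_{i,t}+\delta_{i,t}\boldsymbol s_{i,t}$ with $\boldsymbol s_{i,t}$ uniform on the unit sphere of $\mathbb R^{\tilde{\mathcal N}_i}$; * the adjusted decision is $\boldsymbol x_{i,t}'=\frac{d_{i,t}}{\sum_jx_{i,t}(j)}\boldsymbol x_{i,t}$ if $\sum_jx_{i,t}(j)>d_{i,t}$, and $\boldsymbol x'_{i,t}=\boldsymbol x_{i,t}$ otherwise; $f_{i,t}(\boldsymbol x)$ denotes the loss of node $i$ when it allocates $\boldsymbol x$ and every other node $k$ plays $\boldsymbol x'_{k,t}$; * with $\hat\nabla f_{i,t}=\frac{n_i}{\delta_{i,t}}f_{i,t}(\boldsymbol x_{i,t})\boldsymbol s_{i,t}$ and $\ell_{i,t}(\boldsymbol z)=\langle\hat\nabla f_{i,t},\boldsymbol z-\boldsymbol z_{i,t}\rangle$, the weights become $\omega_{i,t+1}^k=\dfrac{\omega_{i,t}^ke^{-\epsilon_i\ell_{i,t}(\boldsymbol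 z_{i,t}^k)}}{\sum_{m}\omega_{i,t}^{m}e^{-\epsilon_i\ell_{i,t}(\boldsymbol z_{i,t}^{m})}}$; * $q_{i,t+1}=\max\{0,\;q_{i,t}+\gamma_{i,t+1}(g_{i,t}(\boldsymbol x'_{i,t})-\beta_{i,t+1}q_{i,t})\}$; * $\boldsymbol z_{i,t+1}^k=\mathcal P_{(1-\xi_{i,t+1})\mathcal X_i}\big(\boldsymbol z_{i,t}^k-\eta_{i,t+1}^k\hat{\boldsymbol\Gamma}_{i,t+1}\big)$ with $\hat{\boldsymbol\Gamma}_{i,t+1}=\frac{n_i}{\delta_{i,t}}\big[f_{i,t}(\boldsymbol x_{i,t})\boldsymbol s_{i,t}+q_{i,t+1}\,g_{i,t}(\boldsymbol x_{i,t})\boldsymbol s_{i,t}\big]$, where $\mathcal P$ is Euclidean projection. The directions $\boldsymbol s_{i,t}$ are mutually independent, and independent of the generations and of the starting points. **Theorem.** Let $i$ be a node with at least one neighbour. There are constants $C,a$ and, for every $T\ge1$, a learning rate $\epsilon=\epsilon(T)>0$, all depending only on the graph, the node, the centres and radii of the enclosing balls, and the constants $r_k,F_k,G_k$ ($k\in\mathcal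 N$) and $l_{\min}$, such that the following holds for all action sets, demands and generations as above, all deterministic comparator sequences in the action sets, and all $p_k\in[0,P_T^k]$ ($k\in\mathcal N$). If node $i$ uses $\epsilon_i=\epsilon(T)$ (the other nodes may use any learning rates), then the dynamic regret of node $i$ is integrable and $$\mathbb E\Big[\sum_{t=1}^Tf_{i,t}(\boldsymbol x_{i,t})-\sum_{t=1}^Tf_{i,t}(\boldsymbol v_{i,t})\Big]\le C\,(1+\log T)^a\;T^{3/4}\,(1+P_T^i)^{1/2}.$$ -/

import Mathlib

open scoped Pointwise

noncomputable section

namespace ResourceSharing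

/-! ### The network, allocations, loss and constraint -/

open Classical in
/-- The set `N_i` of neighbours of node `i`. -/
def nbhd {V : Type*} [Fintype V] (Gr : SimpleGraph V) (i : V) : Finset V :=
  Finset.univ.filter fun j => Gr.Adj i j

open Classical in
/-- The set `N_i ∪ {i}`. -/
def closedNbhd {V : Type*} [Fintype V] (Gr : SimpleGraph V) (i : V) : Finset V :=
  Finset.univ.filter fun j => j = i ∨ Gr.Adj i j

/-- Allocation vectors of node `i`: coordinate `j` is the amount sent to `j ∈ N_i ∪ {i}`. -/
abbrev Alloc {V : Type*} [Fintype V] (Gr : SimpleGraph V) (i : V) : Type _ :=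
  EuclideanSpace ℝ (closedNbhd Gr i)

open Classical in
/-- The amount that node `k` sends to node `j` in the allocation profile `y`. -/
def transfer {V : Type*} [Fintype V] {Gr : SimpleGraph V} (y : ∀ k, Alloc Gr k) (k j : V) : ℝ :=
  if h : j ∈ closedNbhd Gr k then y k ⟨j, h⟩ else 0

/-- The satisfaction level `min {(∑ x_k(j)) / l_j, 1}` of node `j` under demands `l`. -/
def satisfaction {V : Type*} [Fintype V] {Gr : SimpleGraph V} (l : V → ℝ)
    (y : ∀ k, Alloc Gr k) (j : V) : ℝ :=
  min ((∑ k ∈ closedNbhd Gr j, transfer y k j) / l j) 1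

/-- The loss of node `i`: one minus the average satisfaction over `N_i ∪ {i}`. -/
def loss {V : Type*} [Fintype V] {Gr : SimpleGraph V} (l : V → ℝ)
    (y : ∀ k, Alloc Gr k) (i : V) : ℝ :=
  1 - (1 / ((closedNbhd Gr i).card : ℝ)) * ∑ j ∈ closedNbhd Gr i, satisfaction l y j

/-- The constraint function: total amount distributed minus the generation `d`. -/
def constr {V : Type*} [Fintype V] {Gr : SimpleGraph V} {i : V} (x : Alloc Gr i) (d : ℝ) : ℝ :=
  (∑ j, x j) - d

/-- The adjustment step: an allocation that exceeds the generation is rescaled to it. -/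
def adjust {V : Type*} [Fintype V] {Gr : SimpleGraph V} {i : V} (x : Alloc Gr i) (d : ℝ) :
    Alloc Gr i :=
  if d < ∑ j, x j then (d / ∑ j, x j) • x else x

/-- A network with its constants: `R k`, `r k` are the radii of the balls around and inside the
action set of node `k` (`center k` is the centre of the outer ball), `F k`, `G k` are the bounds
of its loss and constraint functions, and `minDemand` is a lower bound of all demands. -/
structure Network (V : Type*) [Fintype V] where
  graph : SimpleGraph V
  R : V → ℝ
  r : V → ℝ
  F : V → ℝ
  G : V → ℝ
  minDemand : ℝ
  center : ∀ k, Alloc graph k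
  R_pos : ∀ k, 0 < R k
  r_pos : ∀ k, 0 < r k
  F_pos : ∀ k, 0 < F k
  G_pos : ∀ k, 0 < G k
  minDemand_pos : 0 < minDemand

/-- Action sets and demands on a network. -/
structure Scenario {V : Type*} [Fintype V] (net : Network V) where
  action : ∀ k, Set (Alloc net.graph k)
  demand : V → ℕ → ℝ
  action_closed : ∀ k, IsClosed (action k)
  action_convex : ∀ k, Convex ℝ (action k)
  action_nonneg : ∀ k, ∀ x ∈ action k, ∀ j, 0 ≤ x j
  action_subset : ∀ k, action k ⊆ Metric.closedBall (net.center k) (net.R k)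
  ball_subset : ∀ k, ∃ c, Metric.closedBall c (net.r k) ⊆ action k
  demand_ge : ∀ k t, net.minDemand ≤ demand k t
  loss_bounded : ∀ k t, ∀ y : (∀ j, Alloc net.graph j), (∀ j, y j ∈ action j) →
    |loss (fun j => demand j t) y k| ≤ net.F k

/-! ### Parameters of the algorithm -/

section Parameters

variable {V : Type*} [Fintype V] (net : Network V) (k : V)

/-- The Lipschitz constant `L` of the losses. -/
def Network.lip : ℝ := 1 / net.minDemand

/-- `L̃ = 3 L + L R / r`. -/
def Network.lipTilde : ℝ := 3 * net.lip + net.lip * net.R k / net.r k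

/-- The number of neighbours `|N_k|`. -/
def Network.deg : ℝ := ((nbhd net.graph k).card : ℝ)

/-- The dimension of the allocation vectors of node `k`. -/
def Network.dim : ℝ := ((closedNbhd net.graph k).card : ℝ)

/-- The smoothing radius `δ_{k,t}`, computed with path-length value `p`. -/
def Network.delta (p : ℝ) (t : ℕ) : ℝ :=
  (net.deg k * net.F k / net.lipTilde k) ^ (1 / 2 : ℝ) *
    ((net.R k ^ 2 / 2 + net.R k * p) / (t : ℝ)) ^ (1 / 4 : ℝ)

/-- The shrinkage parameter `ξ_{k,t}`. -/
def Network.xi (p : ℝ) (t : ℕ) : ℝ := net.delta k p t / net.r k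

def Network.beta (t : ℕ) : ℝ := 1 / (net.G k * (t : ℝ) ^ (1 / 2 : ℝ))

def Network.gamma (t : ℕ) : ℝ := 1 / (net.G k ^ 2 * (t : ℝ) ^ (1 / 2 : ℝ))

/-- The step size of expert `m = 1, …, K` of node `k` in round `t`. -/
def Network.eta (m t : ℕ) : ℝ :=
  2 ^ (m - 1) * Real.sqrt (2 * net.R k ^ 3 / (2 * net.deg k * net.F k * net.lipTilde k)) *
    (t : ℝ) ^ (-(3 / 4) : ℝ)

/-- The number of experts `K = ⌈(1/2) log₂ (1 + T)⌉ + 1`. -/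
def numExperts (T : ℕ) : ℕ := ⌈(1 / 2 : ℝ) * Real.logb 2 (1 + (T : ℝ))⌉₊ + 1

/-- The prior weight of expert `m` among `K` experts. -/
def priorWeight (K m : ℕ) : ℝ := ((K : ℝ) + 1) / K * (1 / ((m : ℝ) * ((m : ℝ) + 1)))

end Parameters

/-- Euclidean projection onto `S`: a nearest point of `S` (the only one, when `S` is nonempty,
closed and convex). -/
def proj {E : Type*} [NormedAddCommGroup E] (S : Set E) (x : E) : E :=
  Classical.epsilon fun y => y ∈ S ∧ ∀ w ∈ S, ‖x - y‖ ≤ ‖x - w‖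

/-! ### The algorithm MA-NSDRS, run by all nodes simultaneously -/

/-- What determines one run: horizon, learning rates `ε` of the meta algorithms, values `p` used in
the smoothing radii, generations, sampled directions, starting points. -/
structure RunInput {V : Type*} [Fintype V] (net : Network V) where
  T : ℕ
  ε : V → ℝ
  p : V → ℝ
  gen : V → ℕ → ℝ
  dir : ∀ k, ℕ → Alloc net.graph k
  start : ∀ k, Alloc net.graph k

/-- The memory of a node: iterates and weights of its experts, and its dual variable. -/
structure AgentState (E : Type*) where
  expert : ℕ → E
  weight : ℕ → ℝ
  dual : ℝ

section Algorithm

variable {V : Type*} [Fintype V] {net : Network V} (S : Scenario net) (I : RunInput net)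

/-- The combined point `z_{k,t} = ∑_m ω^m_{k,t} z^m_{k,t}`. -/
def combine (k : V) (s : AgentState (Alloc net.graph k)) : Alloc net.graph k :=
  ∑ m ∈ Finset.Icc 1 (numExperts I.T), s.weight m • s.expert m

/-- The perturbed decision `x_{k,t} = z_{k,t} + δ_{k,t} u_{k,t}`. -/
def perturb (t : ℕ) (k : V) (s : AgentState (Alloc net.graph k)) : Alloc net.graph k :=
  combine I k s + net.delta k (I.p k) t • I.dir k t

open Classical in
/-- The loss function of node `k` in round `t`, as a function of its own allocation `x`, when the
other nodes play their adjusted decisions. -/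
def lossFn (t : ℕ) (s : ∀ k, AgentState (Alloc net.graph k)) (k : V)
    (x : Alloc net.graph k) : ℝ :=
  loss (fun j => S.demand j t)
    (Function.update (fun j => adjust (perturb I t j (s j)) (I.gen j t)) k x) k

/-- One-point estimate `(n / δ_{k,t}) f_{k,t}(x_{k,t}) u_{k,t}` of the gradient of the loss. -/
def gradEst (t : ℕ) (s : ∀ k, AgentState (Alloc net.graph k)) (k : V) : Alloc net.graph k :=
  (net.dim k / net.delta k (I.p k) t * lossFn S I t s k (perturb I t k (s k))) • I.dir k t

/-- The dual variable of round `t + 1`. -/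
def nextDual (t : ℕ) (s : ∀ k, AgentState (Alloc net.graph k)) (k : V) : ℝ :=
  max 0 ((s k).dual + net.gamma k (t + 1) *
    (constr (adjust (perturb I t k (s k)) (I.gen k t)) (I.gen k t)
      - net.beta k (t + 1) * (s k).dual))

/-- The update direction of the experts at the start of round `t + 1`: estimate of the gradient of
the loss plus dual variable times the estimate of the gradient of the constraint function. -/
def updateDir (t : ℕ) (s : ∀ k, AgentState (Alloc net.graph k)) (k : V) : Alloc net.graph k :=
  (net.dim k / net.delta k (I.p k) t) •
    (lossFn S I t s k (perturb I t k (s k)) • I.dir k t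
      + (nextDual I t s k * constr (perturb I t k (s k)) (I.gen k t)) • I.dir k t)

/-- The surrogate loss of round `t`. -/
def surrogate (t : ℕ) (s : ∀ k, AgentState (Alloc net.graph k)) (k : V)
    (z : Alloc net.graph k) : ℝ :=
  inner ℝ (gradEst S I t s k) (z - combine I k (s k))

/-- From the memory in round `t` to the memory in round `t + 1`. -/
def nextState (t : ℕ) (s : ∀ k, AgentState (Alloc net.graph k)) (k : V) :
    AgentState (Alloc net.graph k) where
  expert m := proj ((1 - net.xi k (I.p k) (t + 1)) • S.action k)
    ((s k).expert m - net.eta k m (t + 1) • updateDir S I t s k)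
  weight m := (s k).weight m * Real.exp (-I.ε k * surrogate S I t s k ((s k).expert m)) /
    ∑ m' ∈ Finset.Icc 1 (numExperts I.T),
      (s k).weight m' * Real.exp (-I.ε k * surrogate S I t s k ((s k).expert m'))
  dual := nextDual I t s k

/-- The memory in the first round. -/
def firstState (k : V) : AgentState (Alloc net.graph k) where
  expert _ := I.start k
  weight m := priorWeight (numExperts I.T) m
  dual := 0

/-- The memory of all nodes in round `t = 1, 2, …` (the value at `t = 0` is not used). -/
def state : ℕ → ∀ k, AgentState (Alloc net.graph k)
  | 0 => firstState I
  | 1 => firstState I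
  | t + 2 => nextState S I (t + 1) (state (t + 1))

/-- The decision `x_{k,t}`. -/
def decision (k : V) (t : ℕ) : Alloc net.graph k := perturb I t k (state S I t k)

/-- The loss function `f_{k,t}` along the run. -/
def roundLoss (k : V) (t : ℕ) (x : Alloc net.graph k) : ℝ := lossFn S I t (state S I t) k x

/-- The dynamic regret of node `k` in the run, against the comparators `v 1, …, v T`. -/
def dynRegret (k : V) (v : ℕ → Alloc net.graph k) : ℝ :=
  ∑ t ∈ Finset.Icc 1 I.T, roundLoss S I k t (decision S I k t)
    - ∑ t ∈ Finset.Icc 1 I.T, roundLoss S I k t (v t)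

end Algorithm

/-- The path length `P_T = ∑_{t=2}^T ‖v_t - v_{t-1}‖`. -/
def pathLength {E : Type*} [NormedAddCommGroup E] (T : ℕ) (v : ℕ → E) : ℝ :=
  ∑ t ∈ Finset.Icc 2 T, ‖v t - v (t - 1)‖

/-- The uniform distribution on the unit sphere of the allocation space of node `k`. -/
def sphereUniform {V : Type*} [Fintype V] (Gr : SimpleGraph V) (k : V) :
    MeasureTheory.Measure (Metric.sphere (0 : Alloc Gr k) 1) :=
  let σ := (MeasureTheory.volume : MeasureTheory.Measure (Alloc Gr k)).toSphere
  (σ Set.univ)⁻¹ • σ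

end ResourceSharing

end

/-!
The adjusted decision of a node never exceeds its generation, so every dual variable stays `0` and
each expert is plain projected gradient descent on the one-point gradient estimate `ĝ`, in which the
other nodes only enter through their adjusted decisions of the same round.

In its own allocation the loss is convex and separable, with slopes bounded by `L`. Reflecting one
coordinate of the direction, and exchanging two of them, preserve the uniform law on the sphere;
together with the coordinatewise subgradient inequality this makes `ĝ`, conditionally on all other
randomness, a subgradient up to an error of order `L δ_t`.

Since `|f| ≤ F`, the estimate has norm `O(1 / δ_t) = O(t ^ (1/4))`. Descent with steps of order
`t ^ (-3/4)` and shrinkage error `O(δ_t)` then costs `O(T ^ (3/4))` against a comparator when the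
step is tuned to its path length; exponential weights over the geometric grid of steps lose only a
further `O(T ^ (3/4) log T)` against the best expert.
-/

namespace ResourceSharing

open MeasureTheory ProbabilityTheory

/-! ### One-point gradient estimates on the sphere -/

section Sphere

variable {E : Type*} [NormedAddCommGroup E] [InnerProductSpace ℝ E]

/-- The action of a linear isometry on the unit sphere. -/
def sphereMap (e : E ≃ₗᵢ[ℝ] E) (u : Metric.sphere (0 : E) 1) : Metric.sphere (0 : E) 1 :=
  ⟨e u, by simp⟩

theorem continuous_sphereMap (e : E ≃ₗᵢ[ℝ] E) : Continuous (sphereMap e) :=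
  (e.continuous.comp continuous_subtype_val).subtype_mk _

theorem smul_image_preimage_sphereMap (e : E ≃ₗᵢ[ℝ] E) (I : Set ℝ)
    (s : Set (Metric.sphere (0 : E) 1)) :
    I • ((↑) '' (sphereMap e ⁻¹' s) : Set E) = e ⁻¹' (I • ((↑) '' s)) := by
  ext x
  simp only [Set.mem_smul, Set.mem_image, Set.mem_preimage]
  constructor
  · rintro ⟨r, hr, _, ⟨y, hy, rfl⟩, rfl⟩
    exact ⟨r, hr, _, ⟨_, hy, rfl⟩, by simp [sphereMap]⟩
  · rintro ⟨r, hr, _, ⟨y, hy, rfl⟩, h⟩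
    exact ⟨r, hr, _, ⟨sphereMap e.symm y, by simpa [sphereMap] using hy, rfl⟩,
      e.injective (by simpa [sphereMap] using h)⟩

variable [MeasurableSpace E] [BorelSpace E]

/-- Invariance of a measure on the unit sphere under linear isometries: the only property of the
uniform distribution that the gradient estimates rely on. -/
def SphereInvariant (σ : Measure (Metric.sphere (0 : E) 1)) : Prop :=
  ∀ e : E ≃ₗᵢ[ℝ] E, σ.map (sphereMap e) = σ

theorem sphereInvariant_toSphere [FiniteDimensional ℝ E] :
    SphereInvariant (volume : Measure E).toSphere := by
  intro e
  ext s hs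
  have hm : Measurable (sphereMap e) := (continuous_sphereMap e).measurable
  rw [Measure.map_apply hm hs, Measure.toSphere_apply' _ hs, Measure.toSphere_apply' _ (hm hs),
    smul_image_preimage_sphereMap]
  congr 1
  exact MeasurePreserving.measure_preimage_equiv (f := e.toMeasurableEquiv) e.measurePreserving _

theorem SphereInvariant.integral_comp {σ : Measure (Metric.sphere (0 : E) 1)}
    (hσ : SphereInvariant σ) (e : E ≃ₗᵢ[ℝ] E) {g : E → ℝ} (hg : Continuous g) :
    ∫ u, g (e u) ∂σ = ∫ u, g u ∂σ := by
  conv_rhs => rw [← hσ e]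
  exact (integral_map (continuous_sphereMap e).measurable.aemeasurable
    (hg.comp continuous_subtype_val).aestronglyMeasurable (f := fun u => g (u : E))).symm

theorem integrable_sphere [FiniteDimensional ℝ E] (σ : Measure (Metric.sphere (0 : E) 1))
    [IsFiniteMeasure σ] {g : E → ℝ} (hg : Continuous g) :
    Integrable (fun u : Metric.sphere (0 : E) 1 => g u) σ :=
  (hg.comp continuous_subtype_val).integrable_of_hasCompactSupport
    (HasCompactSupport.of_compactSpace _)

end Sphere

section SphereCoordinates

variable {ι : Type*} [Fintype ι] {σ : Measure (Metric.sphere (0 : EuclideanSpace ℝ ι) 1)}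

open Classical in
/-- The reflection that changes the sign of coordinate `k`. -/
noncomputable def coordFlip (k : ι) : EuclideanSpace ℝ ι ≃ₗᵢ[ℝ] EuclideanSpace ℝ ι :=
  LinearIsometryEquiv.piLpCongrRight 2
    (fun j => if j = k then LinearIsometryEquiv.neg ℝ else LinearIsometryEquiv.refl ℝ ℝ)

theorem coordFlip_same (k : ι) (x : EuclideanSpace ℝ ι) : coordFlip k x k = -x k := by
  simp [coordFlip]

theorem coordFlip_of_ne {j k : ι} (h : j ≠ k) (x : EuclideanSpace ℝ ι) :
    coordFlip k x j = x j := by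
  simp [coordFlip, h]

theorem SphereInvariant.integral_mul_coord_eq_zero (hσ : SphereInvariant σ) {j k : ι} (h : j ≠ k)
    {φ : ℝ → ℝ} (hφ : Continuous φ) : ∫ u, φ (u.1 j) * u.1 k ∂σ = 0 := by
  have := hσ.integral_comp (coordFlip k) (g := fun x => φ (x j) * x k) (by fun_prop)
  simp only [coordFlip_same, coordFlip_of_ne h, mul_neg, integral_neg] at this
  linarith

theorem SphereInvariant.integral_coord_eq_zero (hσ : SphereInvariant σ) (k : ι) :
    ∫ u, u.1 k ∂σ = 0 := by
  have := hσ.integral_comp (coordFlip k) (g := fun x => x k) (by fun_prop)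
  simp only [coordFlip_same, integral_neg] at this
  linarith

theorem SphereInvariant.integral_coord_sq_eq (hσ : SphereInvariant σ) (j k : ι) :
    ∫ u, u.1 j ^ 2 ∂σ = ∫ u, u.1 k ^ 2 ∂σ := by
  classical
  have := hσ.integral_comp (LinearIsometryEquiv.piLpCongrLeft 2 ℝ ℝ (Equiv.swap j k))
    (g := fun x => x k ^ 2) (by fun_prop)
  simpa [LinearIsometryEquiv.piLpCongrLeft_apply, Equiv.piCongrLeft'] using this

theorem SphereInvariant.card_mul_integral_coord_sq [IsProbabilityMeasure σ]
    (hσ : SphereInvariant σ) (k : ι) : (Fintype.card ι : ℝ) * ∫ u, u.1 k ^ 2 ∂σ = 1 :=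
  calc (Fintype.card ι : ℝ) * ∫ u, u.1 k ^ 2 ∂σ
    _ = ∑ j, ∫ u, u.1 j ^ 2 ∂σ := by simp [hσ.integral_coord_sq_eq _ k]
    _ = ∫ u, ∑ j, u.1 j ^ 2 ∂σ := (integral_finsetSum _ fun j _ =>
      integrable_sphere σ (g := fun x => x j ^ 2) (by fun_prop)).symm
    _ = 1 := by simp [← EuclideanSpace.real_norm_sq_eq]

theorem SphereInvariant.integral_separable_mul_coord [IsFiniteMeasure σ]
    (hσ : SphereInvariant σ) {φ : ι → ℝ → ℝ} (hφ : ∀ j, Continuous (φ j)) (k : ι) (c : ℝ) :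
    ∫ u, (∑ j, φ j (u.1 j)) * u.1 k ∂σ = ∫ u, (φ k (u.1 k) - c) * u.1 k ∂σ := by
  have hoff : ∀ j ≠ k, ∫ u, φ j (u.1 j) * u.1 k ∂σ = 0 := fun j hj =>
    hσ.integral_mul_coord_eq_zero hj (hφ j)
  simp only [Finset.sum_mul, sub_mul]
  rw [integral_finsetSum _ fun j _ =>
      integrable_sphere σ (g := fun u => φ j (u j) * u k) (by fun_prop),
    integral_sub (integrable_sphere σ (g := fun u => φ k (u k) * u k) (by fun_prop))
      (integrable_sphere σ (g := fun u => c * u k) (by fun_prop)),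
    integral_const_mul, hσ.integral_coord_eq_zero, mul_zero, sub_zero]
  exact Finset.sum_eq_single k (fun j _ hj => hoff j hj) (by simp)

end SphereCoordinates

section OnePoint

theorem exists_subgradient {φ : ℝ → ℝ} (hφ : ConvexOn ℝ Set.univ φ) (x : ℝ) :
    ∃ g, ∀ y, g * (y - x) ≤ φ y - φ x := by
  have hx : x ∈ interior Set.univ := by simp
  refine ⟨derivWithin φ (Set.Ioi x) x, fun y => ?_⟩
  rcases lt_trichotomy x y with hxy | rfl | hyx
  · have h := hφ.rightDeriv_le_slope_of_mem_interior hx (Set.mem_univ y) hxy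
    rwa [slope_def_field, le_div_iff₀ (sub_pos.mpr hxy)] at h
  · simp
  · have h := (hφ.slope_le_leftDeriv_of_mem_interior (Set.mem_univ y) hx hyx).trans
      (hφ.leftDeriv_le_rightDeriv_of_mem_interior hx)
    rw [slope_def_field, div_le_iff₀ (sub_pos.mpr hyx)] at h
    linarith

theorem sub_mul_mul_le_of_convexOn_of_lipschitzWith {φ : ℝ → ℝ} {Λ : NNReal}
    (hφ : ConvexOn ℝ Set.univ φ) (hL : LipschitzWith Λ φ) (z y h : ℝ) :
    (φ (z + y) - φ z) * y * h ≤ y ^ 2 * (φ (z + h) - φ z + 2 * Λ * |y|) := by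
  have hdist : ∀ a b, φ a - φ b ≤ Λ * |a - b| := fun a b =>
    (le_abs_self _).trans (by simpa [Real.dist_eq] using hL.dist_le_mul a b)
  rcases le_total 0 (y * h) with hyh | hyh
  · obtain ⟨g, hg⟩ := exists_subgradient hφ (z + y)
    have hslope : φ (z + y) - φ z ≤ g * y := by linarith [hg z]
    have hgy : g * y ≤ Λ * |y| := by
      calc g * y = g * (z + 2 * y - (z + y)) := by ring
        _ ≤ Λ * |z + 2 * y - (z + y)| := (hg _).trans (hdist _ _)
        _ = Λ * |y| := by ring_nf
    have hgh : g * h ≤ φ (z + h) - φ z + 2 * Λ * |y| := by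
      have hback : φ z - φ (z + y) ≤ Λ * |y| := by simpa using hdist z (z + y)
      linarith [hg (z + h)]
    calc (φ (z + y) - φ z) * y * h = (φ (z + y) - φ z) * (y * h) := by ring
      _ ≤ g * y * (y * h) := by gcongr
      _ = y ^ 2 * (g * h) := by ring
      _ ≤ _ := by gcongr
  · obtain ⟨g, hg⟩ := exists_subgradient hφ z
    have hy : g * y ≤ φ (z + y) - φ z := by simpa using hg (z + y)
    have hh : g * h ≤ φ (z + h) - φ z := by simpa using hg (z + h)
    calc (φ (z + y) - φ z) * y * h = (φ (z + y) - φ z) * (y * h) := by ring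
      _ ≤ g * y * (y * h) := mul_le_mul_of_nonpos_right hy hyh
      _ = y ^ 2 * (g * h) := by ring
      _ ≤ _ := by
        gcongr
        exact hh.trans (le_add_of_nonneg_right (by positivity))

variable {ι : Type*} [Fintype ι] {σ : Measure (Metric.sphere (0 : EuclideanSpace ℝ ι) 1)}
  [IsProbabilityMeasure σ]

theorem SphereInvariant.card_mul_integral_slope_le (hσ : SphereInvariant σ) {φ : ℝ → ℝ}
    {Λ : NNReal} (hφ : ConvexOn ℝ Set.univ φ) (hL : LipschitzWith Λ φ) {δ : ℝ} (hδ : 0 < δ)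
    (k : ι) (z w : ℝ) :
    (Fintype.card ι : ℝ) / δ * (w - z) * ∫ u, (φ (z + δ * u.1 k) - φ z) * u.1 k ∂σ ≤
      φ w - φ z + 2 * Λ * δ := by
  set n := (Fintype.card ι : ℝ)
  have hφc : Continuous φ := hL.continuous
  have hpointwise : ∀ u : Metric.sphere (0 : EuclideanSpace ℝ ι) 1,
      n / δ * (w - z) * ((φ (z + δ * u.1 k) - φ z) * u.1 k) ≤
        n * (φ w - φ z + 2 * Λ * δ) * u.1 k ^ 2 := by
    intro u
    set s : ℝ := u.1 k
    have hs : |s| ≤ 1 := by simpa using PiLp.norm_apply_le u.1 k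
    have hδs : |δ * s| ≤ δ := by
      rw [abs_mul, abs_of_pos hδ]
      exact mul_le_of_le_one_right hδ.le hs
    have hslope := sub_mul_mul_le_of_convexOn_of_lipschitzWith hφ hL z (δ * s) (w - z)
    rw [add_sub_cancel] at hslope
    calc n / δ * (w - z) * ((φ (z + δ * s) - φ z) * s)
      _ = n / δ ^ 2 * ((φ (z + δ * s) - φ z) * (δ * s) * (w - z)) := by field_simp
      _ ≤ n / δ ^ 2 * ((δ * s) ^ 2 * (φ w - φ z + 2 * Λ * |δ * s|)) := by gcongr
      _ ≤ n / δ ^ 2 * ((δ * s) ^ 2 * (φ w - φ z + 2 * Λ * δ)) := by gcongr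
      _ = n * (φ w - φ z + 2 * Λ * δ) * s ^ 2 := by field_simp
  rw [← integral_const_mul]
  calc ∫ u, n / δ * (w - z) * ((φ (z + δ * u.1 k) - φ z) * u.1 k) ∂σ
    _ ≤ ∫ u, n * (φ w - φ z + 2 * Λ * δ) * u.1 k ^ 2 ∂σ :=
      integral_mono
        (integrable_sphere σ (g := fun u => n / δ * (w - z) * ((φ (z + δ * u k) - φ z) * u k))
          (by fun_prop))
        (integrable_sphere σ (g := fun u => n * (φ w - φ z + 2 * Λ * δ) * u k ^ 2) (by fun_prop))
        hpointwise
    _ = φ w - φ z + 2 * Λ * δ := by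
      rw [integral_const_mul, mul_right_comm, hσ.card_mul_integral_coord_sq, one_mul]

theorem SphereInvariant.integral_one_point_estimate_le (hσ : SphereInvariant σ)
    {φ : ι → ℝ → ℝ} {Λ : NNReal} (hφ : ∀ j, ConvexOn ℝ Set.univ (φ j))
    (hL : ∀ j, LipschitzWith Λ (φ j)) {f : EuclideanSpace ℝ ι → ℝ}
    (hf : ∀ x, f x = ∑ j, φ j (x j)) {δ : ℝ} (hδ : 0 < δ) (z w : EuclideanSpace ℝ ι) :
    ∫ u, (f z - f w -
        inner ℝ (((Fintype.card ι : ℝ) / δ * f (z + δ • u.1)) • u.1) (z - w)) ∂σ ≤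
      (Fintype.card ι : ℝ) * (2 * Λ * δ) := by
  set n := (Fintype.card ι : ℝ)
  have hφc : ∀ j, Continuous (φ j) := fun j => (hL j).continuous
  have hfc : Continuous f := by
    rw [funext hf]
    fun_prop
  have hinner : ∀ u : EuclideanSpace ℝ ι, inner ℝ ((n / δ * f (z + δ • u)) • u) (z - w) =
      -∑ k, n / δ * (w k - z k) * (f (z + δ • u) * u k) := by
    intro u
    rw [PiLp.inner_apply, ← Finset.sum_neg_distrib]
    refine Finset.sum_congr rfl fun k _ => ?_
    simp only [PiLp.sub_apply, PiLp.smul_apply, smul_eq_mul, RCLike.inner_apply, conj_trivial]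
    ring
  have hcoord : ∀ k, n / δ * (w k - z k) * ∫ u, f (z + δ • u.1) * u.1 k ∂σ ≤
      φ k (w k) - φ k (z k) + 2 * Λ * δ := by
    intro k
    have hsep := hσ.integral_separable_mul_coord (φ := fun j x => φ j (z j + δ * x))
      (by fun_prop) k (φ k (z k))
    simp only [hf, PiLp.add_apply, PiLp.smul_apply, smul_eq_mul]
    rw [hsep]
    exact hσ.card_mul_integral_slope_le (hφ k) (hL k) hδ k (z k) (w k)
  rw [integral_sub (integrable_const _) (integrable_sphere σ
    (g := fun u => inner ℝ ((n / δ * f (z + δ • u)) • u) (z - w)) (by fun_prop))]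
  simp only [integral_const, probReal_univ, one_smul, hinner, integral_neg, sub_neg_eq_add]
  rw [integral_finsetSum _ fun k _ => integrable_sphere σ
    (g := fun u => n / δ * (w k - z k) * (f (z + δ • u) * u k)) (by fun_prop)]
  simp only [integral_const_mul]
  calc f z - f w + ∑ k, n / δ * (w k - z k) * ∫ u, f (z + δ • u.1) * u.1 k ∂σ
    _ ≤ f z - f w + ∑ k, (φ k (w k) - φ k (z k) + 2 * Λ * δ) := by
      gcongr with k
      exact hcoord k
    _ = n * (2 * Λ * δ) := by
      simp only [hf, Finset.sum_add_distrib, Finset.sum_sub_distrib, Finset.sum_const,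
        Finset.card_univ, nsmul_eq_mul, n]
      ring

end OnePoint

/-! ### Conditioning on all but one member of an independent family -/

section Independence

variable {Ω : Type*} [MeasurableSpace Ω] {P : Measure Ω}

theorem integral_le_of_indepFun_of_forall_integral_le [IsProbabilityMeasure P] {A B : Type*}
    [MeasurableSpace A] [MeasurableSpace B] {X : Ω → A} {Y : Ω → B} (hX : Measurable X)
    (hY : Measurable Y) (hXY : IndepFun X Y P) {h : A × B → ℝ} (hm : Measurable h)
    (hint : Integrable (fun ω => h (X ω, Y ω)) P) {c : ℝ}
    (hc : ∀ ω, ∫ x, h (x, Y ω) ∂(P.map X) ≤ c) :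
    ∫ ω, h (X ω, Y ω) ∂P ≤ c := by
  have hpair : Measurable fun ω => (X ω, Y ω) := hX.prodMk hY
  have : IsProbabilityMeasure (P.map X) := Measure.isProbabilityMeasure_map hX.aemeasurable
  have : IsProbabilityMeasure (P.map Y) := Measure.isProbabilityMeasure_map hY.aemeasurable
  rw [indepFun_iff_map_prod_eq_prod_map_map hX.aemeasurable hY.aemeasurable] at hXY
  have hprod : Integrable h ((P.map X).prod (P.map Y)) := by
    rwa [← hXY, integrable_map_measure hm.aestronglyMeasurable hpair.aemeasurable]
  have hinner : Integrable (fun ω => ∫ x, h (x, Y ω) ∂(P.map X)) P :=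
    (integrable_map_measure hprod.integral_prod_right.aestronglyMeasurable
      hY.aemeasurable).mp hprod.integral_prod_right
  calc ∫ ω, h (X ω, Y ω) ∂P
    _ = ∫ ω, ∫ x, h (x, Y ω) ∂(P.map X) ∂P := by
      rw [← integral_map hpair.aemeasurable hm.aestronglyMeasurable, hXY,
        integral_prod_symm _ hprod,
        integral_map hY.aemeasurable hprod.integral_prod_right.aestronglyMeasurable]
    _ ≤ ∫ _, c ∂P := integral_mono hinner (integrable_const _) hc
    _ = c := by simp

variable {I D : Type*} [DecidableEq I] {X : I → Type*} [∀ a, MeasurableSpace (X a)]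
  [MeasurableSpace D] {U : ∀ a, Ω → X a} {Z : Ω → D}

theorem indepFun_update (hU : ∀ a, Measurable (U a)) (hind : iIndepFun U P) (b : I) (x₀ : X b) :
    IndepFun (U b) (fun ω => Function.update (fun a => U a ω) b x₀) P := by
  have hdisj := indep_iSup_of_disjoint (m := fun a => MeasurableSpace.comap (U a) inferInstance)
    (fun a => (hU a).comap_le) hind.iIndep (S := {b}) (T := {b}ᶜ) (by simp)
  refine indep_of_indep_of_le_left (indep_of_indep_of_le_right hdisj ?_) (by simp)
  rw [← measurable_iff_comap_le]
  refine @measurable_pi_lambda _ _ _ (_) _ _ fun a => ?_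
  by_cases ha : a = b
  · subst ha
    simp only [Function.update_self]
    exact measurable_const
  · simp only [Function.update_of_ne ha]
    rw [measurable_iff_comap_le]
    exact le_iSup₂_of_le a (by simpa using ha) le_rfl

theorem indepFun_update_prod [IsProbabilityMeasure P] (hU : ∀ a, Measurable (U a))
    (hZ : Measurable Z) (hind : iIndepFun U P) (hUZ : IndepFun (fun ω a => U a ω) Z P) (b : I)
    (x₀ : X b) :
    IndepFun (U b) (fun ω => (Function.update (fun a => U a ω) b x₀, Z ω)) P := by
  set W : Ω → ∀ a, X a := fun ω => Function.update (fun a => U a ω) b x₀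
  have hupd : Measurable (fun y : ∀ a, X a => Function.update y b x₀) := measurable_update_left
  have hW : Measurable W := hupd.comp (measurable_pi_lambda _ hU)
  have hUW : IndepFun (U b) W P := indepFun_update hU hind b x₀
  have hUWZ : IndepFun (fun ω => (U b ω, W ω)) Z P :=
    hUZ.comp (φ := fun y => (y b, Function.update y b x₀))
      ((measurable_pi_apply b).prodMk hupd) measurable_id
  have hWZ : IndepFun W Z P := hUZ.comp hupd measurable_id
  rw [indepFun_iff_map_prod_eq_prod_map_map (by fun_prop) (by fun_prop)] at hUW hUWZ hWZ ⊢
  have : IsProbabilityMeasure (P.map (U b)) := Measure.isProbabilityMeasure_map (by fun_prop)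
  have : IsProbabilityMeasure (P.map W) := Measure.isProbabilityMeasure_map (by fun_prop)
  have : IsProbabilityMeasure (P.map Z) := Measure.isProbabilityMeasure_map (by fun_prop)
  rw [hWZ, ← Measure.prodAssoc_prod, ← hUW, ← hUWZ, Measure.map_map (by fun_prop) (by fun_prop)]
  rfl

theorem integral_le_of_forall_integral_update_le [IsProbabilityMeasure P]
    (hU : ∀ a, Measurable (U a)) (hZ : Measurable Z) (hind : iIndepFun U P)
    (hUZ : IndepFun (fun ω a => U a ω) Z P) {h : (∀ a, X a) × D → ℝ} (hm : Measurable h)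
    (hint : Integrable (fun ω => h (fun a => U a ω, Z ω)) P) (b : I) {c : ℝ}
    (hc : ∀ ω, ∫ x, h (Function.update (fun a => U a ω) b x, Z ω) ∂(P.map (U b)) ≤ c) :
    ∫ ω, h (fun a => U a ω, Z ω) ∂P ≤ c := by
  obtain ⟨ω₀⟩ := P.nonempty_of_neZero
  have hW : Measurable fun ω => Function.update (fun a => U a ω) b (U b ω₀) :=
    measurable_update_left.comp (measurable_pi_lambda _ hU)
  have hglue : Measurable fun x : X b × (∀ a, X a) × D =>
      (Function.update x.2.1 b x.1, x.2.2) :=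
    ((measurable_update' (a := b)).comp
      ((measurable_fst.comp measurable_snd).prodMk measurable_fst)).prodMk
        (measurable_snd.comp measurable_snd)
  have := integral_le_of_indepFun_of_forall_integral_le (hU b) (hW.prodMk hZ)
    (indepFun_update_prod hU hZ hind hUZ b (U b ω₀)) (hm.comp hglue) (c := c)
    (by simpa using hint) (by simpa using hc)
  simpa using this

end Independence

/-! ### Fourth roots of integers -/

section FourthRoot

/-- The fourth root of a natural number. All powers of the round number that occur in the
parameters of the algorithm are integral powers of it. -/
noncomputable def fourthRoot (t : ℕ) : ℝ := (t : ℝ) ^ (1 / 4 : ℝ)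

theorem fourthRoot_pow_four (t : ℕ) : fourthRoot t ^ 4 = t := by
  rw [fourthRoot, ← Real.rpow_natCast, ← Real.rpow_mul (by positivity)]
  norm_num

theorem fourthRoot_nonneg (t : ℕ) : 0 ≤ fourthRoot t := by unfold fourthRoot; positivity

theorem one_le_fourthRoot {t : ℕ} (ht : 1 ≤ t) : 1 ≤ fourthRoot t :=
  Real.one_le_rpow (by exact_mod_cast ht) (by norm_num)

theorem fourthRoot_pos {t : ℕ} (ht : 1 ≤ t) : 0 < fourthRoot t :=
  one_pos.trans_le (one_le_fourthRoot ht)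

theorem fourthRoot_one : fourthRoot 1 = 1 := by simp [fourthRoot]

theorem fourthRoot_mono {s t : ℕ} (h : s ≤ t) : fourthRoot s ≤ fourthRoot t :=
  Real.rpow_le_rpow (by positivity) (by exact_mod_cast h) (by norm_num)

theorem one_le_fourthRoot_div {s t : ℕ} (hs : 1 ≤ s) (h : s ≤ t) :
    1 ≤ fourthRoot t / fourthRoot s :=
  (one_le_div (fourthRoot_pos hs)).mpr (fourthRoot_mono h)

theorem rpow_three_quarters (t : ℕ) : (t : ℝ) ^ (3 / 4 : ℝ) = fourthRoot t ^ 3 := by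
  rw [fourthRoot, ← Real.rpow_natCast, ← Real.rpow_mul (by positivity)]
  norm_num

theorem rpow_neg_three_quarters (t : ℕ) : (t : ℝ) ^ (-(3 / 4) : ℝ) = 1 / fourthRoot t ^ 3 := by
  rw [Real.rpow_neg (by positivity), rpow_three_quarters, one_div]

theorem fourthRoot_succ_pow_four (t : ℕ) : fourthRoot (t + 1) ^ 4 = fourthRoot t ^ 4 + 1 := by
  simp [fourthRoot_pow_four]

theorem fourthRoot_succ_cube_sub_le {t : ℕ} (ht : 1 ≤ t) :
    fourthRoot (t + 1) ^ 3 - fourthRoot t ^ 3 ≤ 1 / fourthRoot t := by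
  have hmono := fourthRoot_mono t.le_succ
  rw [le_div_iff₀ (fourthRoot_pos ht)]
  nlinarith [mul_le_mul_of_nonneg_left hmono (pow_nonneg (fourthRoot_nonneg (t + 1)) 3),
    fourthRoot_succ_pow_four t]

theorem inv_fourthRoot_sub_le {t : ℕ} (ht : 1 ≤ t) :
    1 / fourthRoot t - 1 / fourthRoot (t + 1) ≤ 1 / fourthRoot t ^ 5 := by
  have hpos := fourthRoot_pos ht
  have hsucc_pos : 0 < fourthRoot (t + 1) := fourthRoot_pos (by omega)
  have hcube : fourthRoot t ^ 3 ≤ fourthRoot (t + 1) ^ 3 := by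
    gcongr
    exact fourthRoot_mono t.le_succ
  have hsucc : 1 / fourthRoot (t + 1) = fourthRoot (t + 1) ^ 3 / (fourthRoot t ^ 4 + 1) := by
    rw [← fourthRoot_succ_pow_four]
    field_simp
  calc 1 / fourthRoot t - 1 / fourthRoot (t + 1)
    _ ≤ 1 / fourthRoot t - fourthRoot t ^ 3 / (fourthRoot t ^ 4 + 1) := by
      rw [hsucc]
      gcongr
    _ = 1 / (fourthRoot t * (fourthRoot t ^ 4 + 1)) := by
      field_simp
      ring
    _ ≤ 1 / fourthRoot t ^ 5 := by
      gcongr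
      linarith

theorem fourthRoot_succ_le {t : ℕ} (ht : 1 ≤ t) : fourthRoot (t + 1) ≤ 2 * fourthRoot t := by
  have hone := one_le_fourthRoot ht
  refine le_of_pow_le_pow_left₀ (n := 4) (by norm_num) (by positivity) ?_
  rw [fourthRoot_succ_pow_four, mul_pow]
  linarith [one_le_pow₀ hone (n := 4)]

theorem div_fourthRoot_le {a : ℝ} (ha : 0 ≤ a) {t : ℕ} (ht : 1 ≤ t) :
    a / fourthRoot t ≤ 2 * (a / fourthRoot (t + 1)) := by
  rw [← mul_div_assoc, div_le_div_iff₀ (fourthRoot_pos ht) (fourthRoot_pos (by omega))]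
  linarith [mul_le_mul_of_nonneg_left (fourthRoot_succ_le ht) ha]

theorem inv_fourthRoot_cube_le (t : ℕ) :
    1 / fourthRoot (t + 1) ^ 3 ≤ 4 * (fourthRoot (t + 1) - fourthRoot t) := by
  have hpos : 0 < fourthRoot (t + 1) := fourthRoot_pos (by omega)
  have hnonneg := fourthRoot_nonneg t
  have hmono := fourthRoot_mono t.le_succ
  have hfour := fourthRoot_succ_pow_four t
  rw [div_le_iff₀ (by positivity)]
  set a := fourthRoot (t + 1)
  set b := fourthRoot t
  calc 1 = (a - b) * (a ^ 3 + a ^ 2 * b + a * b ^ 2 + b ^ 3) := by linear_combination -hfour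
    _ ≤ (a - b) * (a ^ 3 + a ^ 2 * a + a * a ^ 2 + a ^ 3) := by
      have := sub_nonneg.mpr hmono
      gcongr
    _ = 4 * (a - b) * a ^ 3 := by ring

theorem sum_inv_fourthRoot_cube_le (T : ℕ) :
    ∑ t ∈ Finset.Icc 1 T, 1 / fourthRoot t ^ 3 ≤ 4 * fourthRoot T := by
  induction T with
  | zero => simp [fourthRoot_nonneg]
  | succ T ih =>
    rw [Finset.sum_Icc_succ_top (by omega)]
    linarith [inv_fourthRoot_cube_le T]

theorem sum_fourthRoot_cube_sub_div_sq_le (T : ℕ) :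
    ∑ t ∈ Finset.Icc 1 T, (fourthRoot (t + 1) ^ 3 - fourthRoot t ^ 3) / fourthRoot t ^ 2 ≤
      4 * fourthRoot T := by
  refine (Finset.sum_le_sum fun t ht => ?_).trans (sum_inv_fourthRoot_cube_le T)
  have ht1 := (Finset.mem_Icc.mp ht).1
  calc (fourthRoot (t + 1) ^ 3 - fourthRoot t ^ 3) / fourthRoot t ^ 2
    _ ≤ 1 / fourthRoot t / fourthRoot t ^ 2 := by
      gcongr
      exact fourthRoot_succ_cube_sub_le ht1
    _ = 1 / fourthRoot t ^ 3 := by field_simp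

end FourthRoot

/-! ### Exponential weights -/

section Hedge

variable {κ : Type*} {s : Finset κ}

theorem sum_mul_exp_le {ω x : κ → ℝ} (hω : ∀ m ∈ s, 0 ≤ ω m) (hsum : ∑ m ∈ s, ω m = 1)
    (hmean : ∑ m ∈ s, ω m * x m = 0) {c : ℝ} (hx : ∀ m ∈ s, |x m| ≤ c) :
    ∑ m ∈ s, ω m * Real.exp (x m) ≤ Real.exp (c ^ 2 / 2) := by
  have hchord : ∀ m ∈ s, Real.exp (x m) ≤ Real.cosh c + x m / c * Real.sinh c := by
    intro m hm
    have hxm := hx m hm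
    rcases eq_or_ne c 0 with rfl | hc
    · simp [abs_nonpos_iff.mp hxm]
    · have hratio : |x m / c| ≤ 1 := by
        rw [abs_div]
        exact div_le_one_of_le₀ (hxm.trans (le_abs_self c)) (abs_nonneg c)
      simpa [div_mul_cancel₀ _ hc] using Real.exp_mul_le_cosh_add_mul_sinh hratio c
  calc ∑ m ∈ s, ω m * Real.exp (x m)
    _ ≤ ∑ m ∈ s, ω m * (Real.cosh c + x m / c * Real.sinh c) := by
      gcongr with m hm
      exacts [hω m hm, hchord m hm]
    _ = (∑ m ∈ s, ω m) * Real.cosh c + (∑ m ∈ s, ω m * x m) * (Real.sinh c / c) := by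
      rw [Finset.sum_mul, Finset.sum_mul, ← Finset.sum_add_distrib]
      exact Finset.sum_congr rfl fun m _ => by ring
    _ = Real.cosh c := by rw [hsum, hmean, one_mul, zero_mul, add_zero]
    _ ≤ Real.exp (c ^ 2 / 2) := Real.cosh_le_exp_half_sq c

theorem neg_mul_le_log_sub_log {ω ω' ℓ : κ → ℝ} {c ε : ℝ} (hω : ∀ m ∈ s, 0 < ω m)
    (hsum : ∑ m ∈ s, ω m = 1)
    (hupdate : ∀ m, ω' m = ω m * Real.exp (-ε * ℓ m) / ∑ m' ∈ s, ω m' * Real.exp (-ε * ℓ m'))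
    (hmean : ∑ m ∈ s, ω m * ℓ m = 0) (hc : ∀ m ∈ s, |ℓ m| ≤ c) {k : κ} (hk : k ∈ s) :
    -ε * ℓ k ≤ Real.log (ω' k) - Real.log (ω k) + ε ^ 2 * c ^ 2 / 2 := by
  set Z := ∑ m ∈ s, ω m * Real.exp (-ε * ℓ m)
  have hZ : 0 < Z := Finset.sum_pos (fun m hm => mul_pos (hω m hm) (Real.exp_pos _)) ⟨k, hk⟩
  have hmean' : ∑ m ∈ s, ω m * (-ε * ℓ m) = 0 := by
    simp only [mul_left_comm _ (-ε), ← Finset.mul_sum, hmean, mul_zero]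
  have hlogZ : Real.log Z ≤ (|ε| * c) ^ 2 / 2 := by
    refine (Real.log_le_iff_le_exp hZ).mpr
      (sum_mul_exp_le (fun m hm => (hω m hm).le) hsum hmean' fun m hm => ?_)
    rw [abs_mul, abs_neg]
    gcongr
    exact hc m hm
  rw [mul_pow, sq_abs] at hlogZ
  rw [hupdate, Real.log_div (mul_pos (hω k hk) (Real.exp_pos _)).ne' hZ.ne',
    Real.log_mul (hω k hk).ne' (Real.exp_pos _).ne', Real.log_exp]
  linarith

theorem exponential_weights_regret {ω ℓ : ℕ → κ → ℝ} {c : ℕ → ℝ} {ε : ℝ} (hε : 0 < ε) {T : ℕ}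
    (hω : ∀ t, ∀ m ∈ s, 0 < ω t m) (hsum : ∀ t, ∑ m ∈ s, ω t m = 1)
    (hupdate : ∀ t, 1 ≤ t → ∀ m, ω (t + 1) m = ω t m * Real.exp (-ε * ℓ t m) /
      ∑ m' ∈ s, ω t m' * Real.exp (-ε * ℓ t m'))
    (hmean : ∀ t ∈ Finset.Icc 1 T, ∑ m ∈ s, ω t m * ℓ t m = 0)
    (hc : ∀ t ∈ Finset.Icc 1 T, ∀ m ∈ s, |ℓ t m| ≤ c t) {k : κ} (hk : k ∈ s) :
    -∑ t ∈ Finset.Icc 1 T, ℓ t k ≤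
      Real.log (1 / ω 1 k) / ε + ∑ t ∈ Finset.Icc 1 T, ε * c t ^ 2 / 2 := by
  have hround : ∀ t ∈ Finset.Icc 1 T, -ℓ t k ≤
      (Real.log (ω (t + 1) k) - Real.log (ω t k)) / ε + ε * c t ^ 2 / 2 := by
    intro t ht
    have h := neg_mul_le_log_sub_log (hω t) (hsum t) (hupdate t (Finset.mem_Icc.mp ht).1)
      (hmean t ht) (hc t ht) hk
    rw [← mul_le_mul_iff_right₀ hε, mul_add, mul_div_cancel₀ _ hε.ne']
    linarith
  have hlast : Real.log (ω (T + 1) k) ≤ 0 :=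
    Real.log_nonpos (hω _ k hk).le (hsum (T + 1) ▸
      Finset.single_le_sum (fun m hm => (hω (T + 1) m hm).le) hk)
  calc -∑ t ∈ Finset.Icc 1 T, ℓ t k
    _ = ∑ t ∈ Finset.Icc 1 T, -ℓ t k := (Finset.sum_neg_distrib _).symm
    _ ≤ (Real.log (ω (T + 1) k) - Real.log (ω 1 k)) / ε +
        ∑ t ∈ Finset.Icc 1 T, ε * c t ^ 2 / 2 := by
      rw [← Finset.sum_Ico_sub (fun t => Real.log (ω t k)) (Nat.le_add_left 1 T),
        Finset.Ico_add_one_right_eq_Icc, Finset.sum_div, ← Finset.sum_add_distrib]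
      exact Finset.sum_le_sum hround
    _ ≤ _ := by
      rw [one_div, Real.log_inv]
      gcongr
      linarith

end Hedge

/-! ### Projections and online gradient descent -/

section Projection

variable {E : Type*} [NormedAddCommGroup E] [InnerProductSpace ℝ E] [CompleteSpace E]
  {S : Set E}

theorem proj_spec (hne : S.Nonempty) (hcl : IsClosed S) (hcv : Convex ℝ S) (x : E) :
    proj S x ∈ S ∧ ∀ w ∈ S, ‖x - proj S x‖ ≤ ‖x - w‖ := by
  obtain ⟨y, hy, hdist⟩ := exists_norm_eq_iInf_of_complete_convex hne hcl.isComplete hcv x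
  refine Classical.epsilon_spec (p := fun y => y ∈ S ∧ ∀ w ∈ S, ‖x - y‖ ≤ ‖x - w‖)
    ⟨y, hy, fun w hw => ?_⟩
  rw [hdist]
  exact ciInf_le ⟨0, by rintro _ ⟨_, rfl⟩; exact norm_nonneg _⟩ (⟨w, hw⟩ : S)

theorem inner_sub_proj_nonpos (hne : S.Nonempty) (hcl : IsClosed S) (hcv : Convex ℝ S) (x : E)
    {w : E} (hw : w ∈ S) : inner ℝ (x - proj S x) (w - proj S x) ≤ 0 := by
  obtain ⟨hmem, hmin⟩ := proj_spec hne hcl hcv x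
  have : Nonempty S := hne.to_subtype
  refine (norm_eq_iInf_iff_real_inner_le_zero hcv hmem).mp (le_antisymm ?_ ?_) w hw
  · exact le_ciInf fun w => hmin w w.2
  · exact ciInf_le ⟨0, by rintro _ ⟨_, rfl⟩; exact norm_nonneg _⟩ (⟨_, hmem⟩ : S)

theorem norm_proj_sub_proj_le (hne : S.Nonempty) (hcl : IsClosed S) (hcv : Convex ℝ S)
    (x y : E) : ‖proj S x - proj S y‖ ≤ ‖x - y‖ := by
  have hx := inner_sub_proj_nonpos hne hcl hcv x (proj_spec hne hcl hcv y).1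
  have hy := inner_sub_proj_nonpos hne hcl hcv y (proj_spec hne hcl hcv x).1
  set p := proj S x
  set q := proj S y
  have hsq : ‖p - q‖ * ‖p - q‖ ≤ ‖x - y‖ * ‖p - q‖ := by
    rw [← real_inner_self_eq_norm_mul_norm]
    refine le_trans ?_ (real_inner_le_norm (x - y) (p - q))
    simp only [inner_sub_left, inner_sub_right, real_inner_comm] at hx hy ⊢
    linarith
  by_contra! hlt
  exact hsq.not_gt (mul_lt_mul_of_pos_right hlt ((norm_nonneg _).trans_lt hlt))

theorem proj_eq_self (hne : S.Nonempty) (hcl : IsClosed S) (hcv : Convex ℝ S) {x : E}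
    (hx : x ∈ S) : proj S x = x := by
  have := (proj_spec hne hcl hcv x).2 x hx
  rw [sub_self, norm_zero, norm_le_zero_iff, sub_eq_zero] at this
  exact this.symm

theorem norm_proj_sub_le (hne : S.Nonempty) (hcl : IsClosed S) (hcv : Convex ℝ S) (x : E)
    {w : E} (hw : w ∈ S) : ‖proj S x - w‖ ≤ ‖x - w‖ := by
  simpa [proj_eq_self hne hcl hcv hw] using norm_proj_sub_proj_le hne hcl hcv x w

theorem continuous_proj (hne : S.Nonempty) (hcl : IsClosed S) (hcv : Convex ℝ S) :
    Continuous (proj S) :=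
  (LipschitzWith.of_dist_le_mul (K := 1) fun x y => by
    simpa [dist_eq_norm] using norm_proj_sub_proj_le hne hcl hcv x y).continuous

end Projection

section GradientDescent

theorem sum_mul_sub_by_parts (h a c : ℕ → ℝ) {T : ℕ} (hT : 1 ≤ T) :
    ∑ t ∈ Finset.Icc 1 T, h (t + 1) * (a t - c t) + h (T + 1) * c T =
      h 1 * a 1 + ∑ t ∈ Finset.Icc 1 T, (h (t + 1) - h t) * a t
        + ∑ t ∈ Finset.Icc 2 T, h t * (a t - c (t - 1)) := by
  induction T, hT using Nat.le_induction with
  | base =>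
    simp
    ring
  | succ T hT ih =>
    rw [Finset.sum_Icc_succ_top (by omega), Finset.sum_Icc_succ_top (by omega),
      Finset.sum_Icc_succ_top (by omega), Nat.add_sub_cancel]
    linear_combination ih

variable {E : Type*} [NormedAddCommGroup E]

theorem pathLength_nonneg (T : ℕ) (v : ℕ → E) : 0 ≤ pathLength T v :=
  Finset.sum_nonneg fun _ _ => norm_nonneg _

theorem norm_sub_sq_sub_norm_sub_sq_le (z w w' : E) :
    ‖z - w‖ ^ 2 - ‖z - w'‖ ^ 2 ≤ (2 * ‖z‖ + ‖w‖ + ‖w'‖) * ‖w - w'‖ := by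
  have hsum : ‖z - w‖ + ‖z - w'‖ ≤ 2 * ‖z‖ + ‖w‖ + ‖w'‖ := by
    linarith [norm_sub_le z w, norm_sub_le z w']
  have hdiff : ‖z - w‖ - ‖z - w'‖ ≤ ‖w - w'‖ := by
    have := norm_sub_norm_le (z - w) (z - w')
    rwa [sub_sub_sub_cancel_left, norm_sub_rev w'] at this
  calc ‖z - w‖ ^ 2 - ‖z - w'‖ ^ 2
    _ = (‖z - w‖ + ‖z - w'‖) * (‖z - w‖ - ‖z - w'‖) := by ring
    _ ≤ (‖z - w‖ + ‖z - w'‖) * ‖w - w'‖ := by gcongr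
    _ ≤ _ := by gcongr

theorem sum_fourthRoot_sq_mul_norm_sub_le {w v : ℕ → E} {T : ℕ} {D : ℝ} (hD : 0 ≤ D)
    (hdw : ∀ t ∈ Finset.Icc 2 T, ‖w t - w (t - 1)‖ ≤
      D * (fourthRoot T / fourthRoot t) * ‖v t - v (t - 1)‖
        + D * (fourthRoot T / fourthRoot t ^ 5)) :
    ∑ t ∈ Finset.Icc 2 T, fourthRoot t ^ 2 * ‖w t - w (t - 1)‖ ≤
      D * fourthRoot T ^ 2 * (pathLength T v + 4) := by
  set τ := fourthRoot T
  have hτ : 0 ≤ τ := fourthRoot_nonneg T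
  have hcubes : ∑ t ∈ Finset.Icc 2 T, 1 / fourthRoot t ^ 3 ≤ 4 * τ :=
    (Finset.sum_le_sum_of_subset_of_nonneg (Finset.Icc_subset_Icc_left one_le_two)
      fun t _ _ => one_div_nonneg.mpr (pow_nonneg (fourthRoot_nonneg t) 3)).trans
      (sum_inv_fourthRoot_cube_le T)
  have hterm : ∀ t ∈ Finset.Icc 2 T, fourthRoot t ^ 2 * ‖w t - w (t - 1)‖ ≤
      D * τ ^ 2 * ‖v t - v (t - 1)‖ + D * τ * (1 / fourthRoot t ^ 3) := by
    intro t ht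
    obtain ⟨ht2, htT⟩ := Finset.mem_Icc.mp ht
    have hpos : 0 < fourthRoot t := fourthRoot_pos (by omega)
    have hle : fourthRoot t ≤ τ := fourthRoot_mono htT
    calc fourthRoot t ^ 2 * ‖w t - w (t - 1)‖
      _ ≤ fourthRoot t ^ 2 *
          (D * (τ / fourthRoot t) * ‖v t - v (t - 1)‖ + D * (τ / fourthRoot t ^ 5)) := by
        gcongr
        exact hdw t ht
      _ = D * (τ * fourthRoot t) * ‖v t - v (t - 1)‖ + D * τ * (1 / fourthRoot t ^ 3) := by
        field_simp
      _ ≤ D * τ ^ 2 * ‖v t - v (t - 1)‖ + D * τ * (1 / fourthRoot t ^ 3) := by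
        rw [pow_two τ]
        gcongr
  calc ∑ t ∈ Finset.Icc 2 T, fourthRoot t ^ 2 * ‖w t - w (t - 1)‖
    _ ≤ D * τ ^ 2 * pathLength T v + D * τ * ∑ t ∈ Finset.Icc 2 T, 1 / fourthRoot t ^ 3 := by
      rw [pathLength, Finset.mul_sum, Finset.mul_sum, ← Finset.sum_add_distrib]
      exact Finset.sum_le_sum hterm
    _ ≤ D * τ ^ 2 * pathLength T v + D * τ * (4 * τ) := by gcongr
    _ = D * τ ^ 2 * (pathLength T v + 4) := by ring

theorem sum_fourthRoot_cube_div_mul_norm_sub_le {w v : ℕ → E} {T : ℕ} {b D : ℝ} (hb : 0 < b)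
    (hD : 0 ≤ D) (hdw : ∀ t ∈ Finset.Icc 2 T, ‖w t - w (t - 1)‖ ≤
      D * (fourthRoot T / fourthRoot t) * ‖v t - v (t - 1)‖
        + D * (fourthRoot T / fourthRoot t ^ 5)) :
    ∑ t ∈ Finset.Icc 2 T, fourthRoot t ^ 3 / b *
        (5 * (D * (fourthRoot T / fourthRoot t)) * ‖w t - w (t - 1)‖) ≤
      5 * D * fourthRoot T / b * (D * fourthRoot T ^ 2 * (pathLength T v + 4)) := by
  have := fourthRoot_nonneg T
  refine le_trans (le_of_eq ?_) (mul_le_mul_of_nonneg_left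
    (sum_fourthRoot_sq_mul_norm_sub_le hD hdw) (by positivity))
  rw [Finset.mul_sum]
  refine Finset.sum_congr rfl fun t ht => ?_
  have hpos : 0 < fourthRoot t := fourthRoot_pos (by have := Finset.mem_Icc.mp ht; omega)
  field_simp

theorem sum_norm_sq_div_fourthRoot_cube_le {g : ℕ → E} {T : ℕ} {b c : ℝ} (hb : 0 < b)
    (hg : ∀ t ∈ Finset.Icc 1 T, ‖g t‖ ≤ c) :
    ∑ t ∈ Finset.Icc 1 T, ‖g t‖ ^ 2 / (2 * (fourthRoot (t + 1) ^ 3 / b)) ≤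
      2 * b * c ^ 2 * fourthRoot T := by
  have hterm : ∀ t ∈ Finset.Icc 1 T, ‖g t‖ ^ 2 / (2 * (fourthRoot (t + 1) ^ 3 / b)) ≤
      b * c ^ 2 / 2 * (1 / fourthRoot t ^ 3) := by
    intro t ht
    have hpos := fourthRoot_pos (Finset.mem_Icc.mp ht).1
    calc ‖g t‖ ^ 2 / (2 * (fourthRoot (t + 1) ^ 3 / b))
      _ ≤ c ^ 2 / (2 * (fourthRoot t ^ 3 / b)) := by
        gcongr
        exacts [hg t ht, fourthRoot_mono t.le_succ]
      _ = b * c ^ 2 / 2 * (1 / fourthRoot t ^ 3) := by field_simp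
  calc ∑ t ∈ Finset.Icc 1 T, ‖g t‖ ^ 2 / (2 * (fourthRoot (t + 1) ^ 3 / b))
    _ ≤ b * c ^ 2 / 2 * ∑ t ∈ Finset.Icc 1 T, 1 / fourthRoot t ^ 3 := by
      rw [Finset.mul_sum]
      exact Finset.sum_le_sum hterm
    _ ≤ b * c ^ 2 / 2 * (4 * fourthRoot T) := by
      gcongr
      exact sum_inv_fourthRoot_cube_le T
    _ = 2 * b * c ^ 2 * fourthRoot T := by ring

variable [InnerProductSpace ℝ E]

theorem inner_le_of_norm_le {z z' g w : E} {η : ℝ} (hη : 0 < η)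
    (h : ‖z' - w‖ ≤ ‖z - η⁻¹ • g - w‖) :
    inner ℝ g (z - w) ≤ η * (‖z - w‖ ^ 2 - ‖z' - w‖ ^ 2) / 2 + ‖g‖ ^ 2 / (2 * η) := by
  have hsq : ‖z' - w‖ ^ 2 ≤ ‖z - η⁻¹ • g - w‖ ^ 2 := by gcongr
  rw [sub_right_comm, norm_sub_sq_real (z - w), inner_smul_right, norm_smul, mul_pow,
    Real.norm_eq_abs, sq_abs, real_inner_comm] at hsq
  have hscaled := mul_le_mul_of_nonneg_left hsq hη.le
  have hexpand : η * (‖z - w‖ ^ 2 - 2 * (η⁻¹ * inner ℝ g (z - w)) + η⁻¹ ^ 2 * ‖g‖ ^ 2) =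
      η * ‖z - w‖ ^ 2 - 2 * inner ℝ g (z - w) + 2 * (‖g‖ ^ 2 / (2 * η)) := by
    field_simp
  linarith

theorem sum_inner_sub_le_of_descent {z g w : ℕ → E} {h : ℕ → ℝ} {T : ℕ} (hT : 1 ≤ T)
    (hpos : ∀ t, 1 ≤ t → 0 < h t)
    (hstep : ∀ t ∈ Finset.Icc 1 T, ‖z (t + 1) - w t‖ ≤ ‖z t - (h (t + 1))⁻¹ • g t - w t‖) :
    ∑ t ∈ Finset.Icc 1 T, inner ℝ (g t) (z t - w t) ≤
      (h 1 * ‖z 1 - w 1‖ ^ 2 + ∑ t ∈ Finset.Icc 1 T, (h (t + 1) - h t) * ‖z t - w t‖ ^ 2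
        + ∑ t ∈ Finset.Icc 2 T, h t * (‖z t - w t‖ ^ 2 - ‖z t - w (t - 1)‖ ^ 2)) / 2
        + ∑ t ∈ Finset.Icc 1 T, ‖g t‖ ^ 2 / (2 * h (t + 1)) := by
  have hround : ∀ t ∈ Finset.Icc 1 T, inner ℝ (g t) (z t - w t) ≤
      h (t + 1) * (‖z t - w t‖ ^ 2 - ‖z (t + 1) - w t‖ ^ 2) / 2
        + ‖g t‖ ^ 2 / (2 * h (t + 1)) := fun t ht =>
    inner_le_of_norm_le (hpos _ (by omega)) (hstep t ht)
  have hparts := sum_mul_sub_by_parts h (fun t => ‖z t - w t‖ ^ 2)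
    (fun t => ‖z (t + 1) - w t‖ ^ 2) hT
  have hlast : 0 ≤ h (T + 1) * ‖z (T + 1) - w T‖ ^ 2 :=
    mul_nonneg (hpos _ (by omega)).le (sq_nonneg _)
  have hshift : ∑ t ∈ Finset.Icc 2 T, h t * (‖z t - w t‖ ^ 2 - ‖z (t - 1 + 1) - w (t - 1)‖ ^ 2) =
      ∑ t ∈ Finset.Icc 2 T, h t * (‖z t - w t‖ ^ 2 - ‖z t - w (t - 1)‖ ^ 2) :=
    Finset.sum_congr rfl fun t ht => by
      rw [Nat.sub_add_cancel (by have := Finset.mem_Icc.mp ht; omega)]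
  refine (Finset.sum_le_sum hround).trans ?_
  rw [Finset.sum_add_distrib, ← Finset.sum_div]
  linarith

theorem sum_inner_sub_le_of_descent_of_norm_le {z g w : ℕ → E} {h ρ : ℕ → ℝ} {T : ℕ}
    (hT : 1 ≤ T) (hpos : ∀ t, 1 ≤ t → 0 < h t) (hmono : Monotone h)
    (hstep : ∀ t ∈ Finset.Icc 1 T, ‖z (t + 1) - w t‖ ≤ ‖z t - (h (t + 1))⁻¹ • g t - w t‖)
    (hz : ∀ t ∈ Finset.Icc 1 T, ‖z t‖ ≤ ρ t) (hw : ∀ t ∈ Finset.Icc 1 T, ‖w t‖ ≤ ρ t)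
    (hρ : ∀ t ∈ Finset.Icc 2 T, ρ (t - 1) ≤ 2 * ρ t) :
    ∑ t ∈ Finset.Icc 1 T, inner ℝ (g t) (z t - w t) ≤
      (h 1 * (4 * ρ 1 ^ 2) + ∑ t ∈ Finset.Icc 1 T, (h (t + 1) - h t) * (4 * ρ t ^ 2)
        + ∑ t ∈ Finset.Icc 2 T, h t * (5 * ρ t * ‖w t - w (t - 1)‖)) / 2
        + ∑ t ∈ Finset.Icc 1 T, ‖g t‖ ^ 2 / (2 * h (t + 1)) := by
  have hdiam : ∀ t ∈ Finset.Icc 1 T, ‖z t - w t‖ ^ 2 ≤ 4 * ρ t ^ 2 := by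
    intro t ht
    have : ‖z t - w t‖ ≤ 2 * ρ t := by linarith [norm_sub_le (z t) (w t), hz t ht, hw t ht]
    calc ‖z t - w t‖ ^ 2 ≤ (2 * ρ t) ^ 2 := by gcongr
      _ = 4 * ρ t ^ 2 := by ring
  have hdrift : ∀ t ∈ Finset.Icc 2 T, ‖z t - w t‖ ^ 2 - ‖z t - w (t - 1)‖ ^ 2 ≤
      5 * ρ t * ‖w t - w (t - 1)‖ := by
    intro t ht
    obtain ⟨ht2, htT⟩ := Finset.mem_Icc.mp ht
    have hmem : t ∈ Finset.Icc 1 T := Finset.mem_Icc.mpr ⟨by omega, htT⟩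
    have hmem' : t - 1 ∈ Finset.Icc 1 T := Finset.mem_Icc.mpr ⟨by omega, by omega⟩
    have hnorms : 2 * ‖z t‖ + ‖w t‖ + ‖w (t - 1)‖ ≤ 5 * ρ t := by
      linarith [hz t hmem, hw t hmem, hw (t - 1) hmem', hρ t ht]
    exact (norm_sub_sq_sub_norm_sub_sq_le _ _ _).trans (by gcongr)
  refine (sum_inner_sub_le_of_descent hT hpos hstep).trans ?_
  gcongr ((?_ + ∑ t ∈ _, ?_) + ∑ t ∈ _, ?_) / _ + _ with t ht t ht
  · exact mul_le_mul_of_nonneg_left (hdiam 1 (Finset.mem_Icc.mpr ⟨le_rfl, hT⟩)) (hpos 1 le_rfl).le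
  · exact mul_le_mul_of_nonneg_left (hdiam t ht) (sub_nonneg.mpr (hmono t.le_succ))
  · exact mul_le_mul_of_nonneg_left (hdrift t ht)
      (hpos t (by have := Finset.mem_Icc.mp ht; omega)).le

theorem online_gradient_descent_regret {z g w v : ℕ → E} {T : ℕ} (hT : 1 ≤ T) {b D Γ : ℝ}
    (hb : 0 < b) (hD : 0 ≤ D)
    (hstep : ∀ t ∈ Finset.Icc 1 T,
      ‖z (t + 1) - w t‖ ≤ ‖z t - (b / fourthRoot (t + 1) ^ 3) • g t - w t‖)
    (hz : ∀ t ∈ Finset.Icc 1 T, ‖z t‖ ≤ D * (fourthRoot T / fourthRoot t))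
    (hw : ∀ t ∈ Finset.Icc 1 T, ‖w t‖ ≤ D * (fourthRoot T / fourthRoot t))
    (hg : ∀ t ∈ Finset.Icc 1 T, ‖g t‖ ≤ Γ * fourthRoot T)
    (hdw : ∀ t ∈ Finset.Icc 2 T, ‖w t - w (t - 1)‖ ≤
      D * (fourthRoot T / fourthRoot t) * ‖v t - v (t - 1)‖
        + D * (fourthRoot T / fourthRoot t ^ 5)) :
    ∑ t ∈ Finset.Icc 1 T, inner ℝ (g t) (z t - w t) ≤
      20 * D ^ 2 * fourthRoot T ^ 3 * (1 + pathLength T v) / b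
        + 2 * b * Γ ^ 2 * fourthRoot T ^ 3 := by
  have hτ := one_le_fourthRoot hT
  have hregret := sum_inner_sub_le_of_descent_of_norm_le (h := fun t => fourthRoot t ^ 3 / b)
    (ρ := fun t => D * (fourthRoot T / fourthRoot t)) hT
    (fun t ht => div_pos (pow_pos (fourthRoot_pos ht) 3) hb)
    (fun s t hst => by
      have := fourthRoot_nonneg s
      exact div_le_div_of_nonneg_right (pow_le_pow_left₀ this (fourthRoot_mono hst) 3) hb.le)
    (fun t ht => by simpa only [inv_div] using hstep t ht) hz hw fun t ht => by
      obtain ⟨s, rfl⟩ : ∃ s, t = s + 1 := ⟨t - 1, by have := Finset.mem_Icc.mp ht; omega⟩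
      have hs : 1 ≤ s := by have := Finset.mem_Icc.mp ht; omega
      rw [Nat.add_sub_cancel, mul_left_comm]
      exact mul_le_mul_of_nonneg_left (div_fourthRoot_le (fourthRoot_nonneg T) hs) hD
  set τ := fourthRoot T
  have hinit : fourthRoot 1 ^ 3 / b * (4 * (D * (τ / fourthRoot 1)) ^ 2) ≤
      4 * D ^ 2 * τ ^ 3 / b := by
    rw [fourthRoot_one, one_pow, div_one, mul_pow, div_mul_eq_mul_div, one_mul, ← mul_assoc]
    gcongr
    norm_num
  have hincr : ∑ t ∈ Finset.Icc 1 T, (fourthRoot (t + 1) ^ 3 / b - fourthRoot t ^ 3 / b) *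
      (4 * (D * (τ / fourthRoot t)) ^ 2) ≤ 4 * D ^ 2 * τ ^ 2 / b * (4 * τ) := by
    refine le_trans (le_of_eq ?_) (mul_le_mul_of_nonneg_left
      (sum_fourthRoot_cube_sub_div_sq_le T) (by positivity))
    rw [Finset.mul_sum]
    exact Finset.sum_congr rfl fun t _ => by ring
  have hdrift := sum_fourthRoot_cube_div_mul_norm_sub_le hb hD hdw
  have hgrad := sum_norm_sq_div_fourthRoot_cube_le hb hg
  have hP : 0 ≤ D ^ 2 * τ ^ 3 * pathLength T v / b := by
    have := pathLength_nonneg T v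
    positivity
  calc _ ≤ (4 * D ^ 2 * τ ^ 3 / b + 4 * D ^ 2 * τ ^ 2 / b * (4 * τ)
        + 5 * D * τ / b * (D * τ ^ 2 * (pathLength T v + 4))) / 2
        + 2 * b * (Γ * τ) ^ 2 * τ := hregret.trans (by gcongr)
    _ = 20 * D ^ 2 * τ ^ 3 * (1 + pathLength T v) / b + 2 * b * Γ ^ 2 * τ ^ 3
        - 35 / 2 * (D ^ 2 * τ ^ 3 * pathLength T v / b) := by ring
    _ ≤ _ := by linarith

end GradientDescent

/-! ### The loss of a node -/

section Loss

variable {V : Type*} [Fintype V] {Gr : SimpleGraph V}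

theorem mem_closedNbhd {i j : V} : j ∈ closedNbhd Gr i ↔ j = i ∨ Gr.Adj i j := by
  simp [closedNbhd]

theorem mem_closedNbhd_comm {i j : V} : j ∈ closedNbhd Gr i ↔ i ∈ closedNbhd Gr j := by
  rw [mem_closedNbhd, mem_closedNbhd, eq_comm, Gr.adj_comm]

theorem closedNbhd_card_pos (i : V) : (0 : ℝ) < (closedNbhd Gr i).card := by
  exact_mod_cast Finset.card_pos.mpr ⟨i, mem_closedNbhd.mpr (Or.inl rfl)⟩

theorem abs_transfer_le (y : ∀ k, Alloc Gr k) (k j : V) : |transfer y k j| ≤ ‖y k‖ := by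
  unfold transfer
  split_ifs with h
  · exact PiLp.norm_apply_le (y k) ⟨j, h⟩
  · simp

theorem satisfaction_le_one (l : V → ℝ) (y : ∀ k, Alloc Gr k) (j : V) :
    satisfaction l y j ≤ 1 :=
  min_le_right _ _

theorem neg_le_satisfaction {l : V → ℝ} {lmin : ℝ} (hlmin : 0 < lmin) (hl : ∀ j, lmin ≤ l j)
    (y : ∀ k, Alloc Gr k) (j : V) : -(1 / lmin * ∑ k, ‖y k‖) ≤ satisfaction l y j := by
  have hnonneg : 0 ≤ 1 / lmin * ∑ k, ‖y k‖ := by positivity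
  refine le_min ((abs_le.mp ?_).1) (by linarith)
  have hsum : |∑ k ∈ closedNbhd Gr j, transfer y k j| ≤ ∑ k, ‖y k‖ :=
    calc |∑ k ∈ closedNbhd Gr j, transfer y k j|
      _ ≤ ∑ k ∈ closedNbhd Gr j, |transfer y k j| := Finset.abs_sum_le_sum_abs _ _
      _ ≤ ∑ k ∈ closedNbhd Gr j, ‖y k‖ := Finset.sum_le_sum fun k _ => abs_transfer_le y k j
      _ ≤ ∑ k, ‖y k‖ := Finset.sum_le_sum_of_subset_of_nonneg (Finset.subset_univ _)
        fun _ _ _ => norm_nonneg _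
  rw [abs_div, abs_of_pos (hlmin.trans_le (hl j)), one_div_mul_eq_div]
  exact div_le_div₀ ((abs_nonneg _).trans hsum) hsum hlmin (hl j)

theorem loss_eq_sum (l : V → ℝ) (y : ∀ k, Alloc Gr k) (i : V) :
    loss l y i =
      (1 / ((closedNbhd Gr i).card : ℝ)) * ∑ j ∈ closedNbhd Gr i, (1 - satisfaction l y j) := by
  have hn := (closedNbhd_card_pos (Gr := Gr) i).ne'
  rw [loss, Finset.sum_sub_distrib, Finset.sum_const, nsmul_one, mul_sub, one_div_mul_cancel hn]

theorem loss_nonneg (l : V → ℝ) (y : ∀ k, Alloc Gr k) (i : V) : 0 ≤ loss l y i := by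
  rw [loss_eq_sum]
  exact mul_nonneg (by positivity)
    (Finset.sum_nonneg fun j _ => sub_nonneg.mpr (satisfaction_le_one l y j))

theorem loss_le {l : V → ℝ} {lmin : ℝ} (hlmin : 0 < lmin) (hl : ∀ j, lmin ≤ l j)
    (y : ∀ k, Alloc Gr k) (i : V) : loss l y i ≤ 1 + 1 / lmin * ∑ k, ‖y k‖ := by
  have hsum := Finset.sum_le_card_nsmul (closedNbhd Gr i) (fun j => 1 - satisfaction l y j)
    (1 + 1 / lmin * ∑ k, ‖y k‖) fun j _ => by linarith [neg_le_satisfaction hlmin hl y j]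
  rwa [loss_eq_sum, one_div, inv_mul_le_iff₀ (closedNbhd_card_pos i), ← nsmul_eq_mul]

/-- The unsatisfied share of a demand `l` that receives `u` from one distinguished node and `c` from
all others. The loss of that node is an average of such functions of its own allocations `u`. -/
noncomputable def deficit (c l u : ℝ) : ℝ := 1 - min ((c + u) / l) 1

theorem convexOn_deficit (c l : ℝ) : ConvexOn ℝ Set.univ (deficit c l) := by
  have haffine : ConcaveOn ℝ Set.univ fun u : ℝ => (c + u) / l := by
    refine ⟨convex_univ, fun u _ v _ a b _ _ hab => le_of_eq ?_⟩
    simp only [smul_eq_mul]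
    linear_combination (c / l) * hab
  exact (convexOn_const 1 convex_univ).sub (haffine.inf (concaveOn_const 1 convex_univ))

theorem abs_deficit_sub_le {c l : ℝ} (hl : 0 < l) (u v : ℝ) :
    |deficit c l u - deficit c l v| ≤ |u - v| / l := by
  have hmin := abs_min_sub_min_le_max ((c + v) / l) 1 ((c + u) / l) 1
  rwa [sub_self, abs_zero, max_eq_left (abs_nonneg _), ← sub_div, add_sub_add_left_eq_sub,
    abs_div, abs_of_pos hl, abs_sub_comm v u, ← sub_sub_sub_cancel_left _ _ (1 : ℝ)] at hmin

open Classical in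
/-- The amount that node `j` receives from all nodes but `i`. -/
noncomputable def supplyOfOthers (y : ∀ k, Alloc Gr k) (i j : V) : ℝ :=
  ∑ k ∈ (closedNbhd Gr j).erase i, transfer y k j

open Classical in
theorem satisfaction_update (l : V → ℝ) (y : ∀ k, Alloc Gr k) (i : V) (x : Alloc Gr i)
    (j : closedNbhd Gr i) :
    1 - satisfaction l (Function.update y i x) j = deficit (supplyOfOthers y i j) (l j) (x j) := by
  have hothers : ∀ k ∈ (closedNbhd Gr j).erase i,
      transfer (Function.update y i x) k j = transfer y k j := fun k hk => by
    simp only [transfer, Function.update_of_ne (Finset.ne_of_mem_erase hk)]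
  rw [satisfaction, deficit, supplyOfOthers,
    ← Finset.sum_erase_add _ _ (mem_closedNbhd_comm.mp j.2), Finset.sum_congr rfl hothers]
  simp only [transfer, Function.update_self, j.2, dif_pos]

open Classical in
theorem loss_update (l : V → ℝ) (y : ∀ k, Alloc Gr k) (i : V) (x : Alloc Gr i) :
    loss l (Function.update y i x) i = ∑ j : closedNbhd Gr i,
      1 / ((closedNbhd Gr i).card : ℝ) * deficit (supplyOfOthers y i j) (l j) (x j) := by
  rw [loss_eq_sum, ← Finset.sum_coe_sort, ← Finset.mul_sum]
  simp only [satisfaction_update]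

variable {i : V}

open Classical in
theorem abs_loss_update_sub_le {l : V → ℝ} {lmin : ℝ} (hlmin : 0 < lmin) (hl : ∀ j, lmin ≤ l j)
    (y : ∀ k, Alloc Gr k) (i : V) (x x' : Alloc Gr i) :
    |loss l (Function.update y i x) i - loss l (Function.update y i x') i| ≤
      1 / lmin * ‖x - x'‖ := by
  have hn := closedNbhd_card_pos (Gr := Gr) i
  have hterm : ∀ j ∈ Finset.univ (α := closedNbhd Gr i),
      |deficit (supplyOfOthers y i j) (l j) (x j) - deficit (supplyOfOthers y i j) (l j) (x' j)| ≤
        1 / lmin * ‖x - x'‖ := by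
    intro j _
    rw [one_div_mul_eq_div]
    refine (abs_deficit_sub_le (hlmin.trans_le (hl j)) _ _).trans ?_
    gcongr
    exacts [PiLp.norm_apply_le (x - x') j, hl j]
  rw [loss_update, loss_update, ← Finset.sum_sub_distrib]
  simp only [← mul_sub]
  rw [← Finset.mul_sum, abs_mul, abs_of_pos (one_div_pos.mpr hn), one_div,
    inv_mul_le_iff₀ hn]
  simpa using (Finset.abs_sum_le_sum_abs _ _).trans (Finset.sum_le_card_nsmul _ _ _ hterm)

open Classical in
theorem integral_loss_one_point_estimate_le
    {σ : Measure (Metric.sphere (0 : Alloc Gr i) 1)} [IsProbabilityMeasure σ]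
    (hσ : SphereInvariant σ) {l : V → ℝ} {lmin : ℝ} (hlmin : 0 < lmin) (hl : ∀ j, lmin ≤ l j)
    (y : ∀ k, Alloc Gr k) {f : Alloc Gr i → ℝ}
    (hf : ∀ x, f x = loss l (Function.update y i x) i) {δ : ℝ} (hδ : 0 < δ) (z w : Alloc Gr i) :
    ∫ u, (f z - f w - inner ℝ
      ((((closedNbhd Gr i).card : ℝ) / δ * f (z + δ • u.1)) • u.1) (z - w)) ∂σ ≤
      2 * (1 / lmin) * δ := by
  have hn := closedNbhd_card_pos (Gr := Gr) i
  have h := hσ.integral_one_point_estimate_le (Λ := (1 / lmin / (closedNbhd Gr i).card).toNNReal)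
    (φ := fun j u => 1 / ((closedNbhd Gr i).card : ℝ) * deficit (supplyOfOthers y i j) (l j) u)
    (fun j => (convexOn_deficit _ _).smul (one_div_nonneg.mpr hn.le))
    (fun j => LipschitzWith.of_dist_le_mul fun u v => ?_)
    (fun x => (hf x).trans (loss_update l y i x)) hδ z w
  · rw [Fintype.card_coe, Real.coe_toNNReal _ (by positivity)] at h
    refine h.trans (le_of_eq ?_)
    field_simp
  · have hΛ : 0 ≤ 1 / lmin / ((closedNbhd Gr i).card : ℝ) := by positivity
    have hdeficit : |deficit (supplyOfOthers y i j) (l j) u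
        - deficit (supplyOfOthers y i j) (l j) v| ≤ |u - v| / lmin :=
      (abs_deficit_sub_le (hlmin.trans_le (hl j)) u v).trans (by gcongr; exact hl j)
    rw [Real.dist_eq, Real.dist_eq, ← mul_sub, abs_mul, abs_of_pos (one_div_pos.mpr hn),
      Real.coe_toNNReal _ hΛ]
    exact (mul_le_mul_of_nonneg_left hdeficit (one_div_nonneg.mpr hn.le)).trans_eq (by ring)

theorem constr_adjust_nonpos (x : Alloc Gr i) {d : ℝ} (hd : 0 ≤ d) :
    constr (adjust x d) d ≤ 0 := by
  unfold constr adjust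
  split_ifs with h
  · have hsum : ∑ j, x j ≠ 0 := (hd.trans_lt h).ne'
    simp only [PiLp.smul_apply, smul_eq_mul, ← Finset.mul_sum]
    rw [div_mul_cancel₀ _ hsum, sub_self]
  · linarith

theorem norm_adjust_le (x : Alloc Gr i) {d : ℝ} (hd : 0 ≤ d) : ‖adjust x d‖ ≤ ‖x‖ := by
  unfold adjust
  split_ifs with h
  · have hsum : 0 < ∑ j, x j := hd.trans_lt h
    rw [norm_smul, Real.norm_eq_abs, abs_of_nonneg (by positivity)]
    exact mul_le_of_le_one_left (norm_nonneg _) ((div_le_one hsum).mpr h.le)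
  · exact le_rfl

end Loss

/-! ### Constants of the network -/

section Constants

variable {V : Type*} [Fintype V] (net : Network V) (k : V)

theorem Network.lip_pos : 0 < net.lip := one_div_pos.mpr net.minDemand_pos

theorem Network.lipTilde_pos : 0 < net.lipTilde k := by
  have := net.lip_pos
  have := net.R_pos k
  have := net.r_pos k
  unfold Network.lipTilde
  positivity

theorem Network.deg_pos {k : V} (hk : (nbhd net.graph k).Nonempty) : 0 < net.deg k := by
  unfold Network.deg
  exact_mod_cast Finset.card_pos.mpr hk

theorem Network.dim_pos : 0 < net.dim k := closedNbhd_card_pos k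

theorem Network.deg_mul_F_div_lipTilde_nonneg : 0 ≤ net.deg k * net.F k / net.lipTilde k :=
  div_nonneg (mul_nonneg (Nat.cast_nonneg _) (net.F_pos k).le) (net.lipTilde_pos k).le

/-- A bound of the norms of the actions of node `k`. -/
noncomputable def Network.actionBound : ℝ := ‖net.center k‖ + net.R k

theorem Network.actionBound_pos : 0 < net.actionBound k :=
  add_pos_of_nonneg_of_pos (norm_nonneg _) (net.R_pos k)

/-- The coefficient of `t ^ (-1/4)` in the smoothing radius `δ_{k,t}` that is computed with the
path-length value `p`. -/
noncomputable def Network.deltaCoeff (p : ℝ) : ℝ :=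
  (net.deg k * net.F k / net.lipTilde k) ^ (1 / 2 : ℝ) *
    (net.R k ^ 2 / 2 + net.R k * p) ^ (1 / 4 : ℝ)

theorem Network.delta_eq {p : ℝ} (hp : 0 ≤ p) (t : ℕ) :
    net.delta k p t = net.deltaCoeff k p / fourthRoot t := by
  have := net.R_pos k
  unfold Network.delta Network.deltaCoeff fourthRoot
  rw [Real.div_rpow (x := net.R k ^ 2 / 2 + net.R k * p) (by positivity) (by positivity)]
  ring

theorem Network.deltaCoeff_nonneg {p : ℝ} (hp : 0 ≤ p) : 0 ≤ net.deltaCoeff k p := by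
  have := net.R_pos k
  have := net.deg_mul_F_div_lipTilde_nonneg k
  unfold Network.deltaCoeff
  positivity

theorem Network.deltaCoeff_zero_pos {k : V} (hk : (nbhd net.graph k).Nonempty) :
    0 < net.deltaCoeff k 0 := by
  have := net.R_pos k
  have := net.deg_pos hk
  have := net.F_pos k
  have := net.lipTilde_pos k
  unfold Network.deltaCoeff
  positivity

theorem Network.deltaCoeff_le_mul {p q c : ℝ} (hp : 0 ≤ p) (hc : 1 ≤ c) (h : p ≤ q * c) :
    net.deltaCoeff k p ≤ net.deltaCoeff k q * c ^ (1 / 4 : ℝ) := by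
  have hR := net.R_pos k
  have hq : 0 ≤ q := nonneg_of_mul_nonneg_left (hp.trans h) (by linarith)
  have := net.deg_mul_F_div_lipTilde_nonneg k
  unfold Network.deltaCoeff
  rw [mul_assoc, ← Real.mul_rpow (by positivity) (by positivity)]
  gcongr
  calc net.R k ^ 2 / 2 + net.R k * p
      ≤ net.R k ^ 2 / 2 * c + net.R k * (q * c) := by
        gcongr
        exact le_mul_of_one_le_right (by positivity) hc
    _ = (net.R k ^ 2 / 2 + net.R k * q) * c := by ring

theorem Network.deltaCoeff_zero_le {p : ℝ} (hp : 0 ≤ p) :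
    net.deltaCoeff k 0 ≤ net.deltaCoeff k p := by
  simpa using net.deltaCoeff_le_mul k (q := p) le_rfl le_rfl (by simpa using hp)

theorem Network.deltaCoeff_le_mul_fourthRoot {p : ℝ} (hp : 0 ≤ p) {T : ℕ} (hT : 1 ≤ T)
    (hpT : p ≤ 2 * net.R k * T) :
    net.deltaCoeff k p ≤ net.deltaCoeff k (2 * net.R k) * fourthRoot T :=
  net.deltaCoeff_le_mul k hp (by exact_mod_cast hT) hpT

theorem Network.deltaCoeff_le_mul_sqrt {p P : ℝ} (hp : 0 ≤ p) (hP : p ≤ P) :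
    net.deltaCoeff k p ≤ net.deltaCoeff k 1 * √(1 + P) := by
  have := net.deltaCoeff_nonneg k zero_le_one
  refine (net.deltaCoeff_le_mul k (q := 1) (c := 1 + P) hp (by linarith) (by linarith)).trans ?_
  rw [Real.sqrt_eq_rpow]
  gcongr
  · linarith
  · norm_num

/-- `reach k * (T / t) ^ (1 / 4)` bounds the norms of the iterates and decisions of node `k` in
round `t`. The growth for small `t` is due to `δ_{k,t}` and `ξ_{k,t}`, which may exceed `1`. -/
noncomputable def Network.reach : ℝ :=
  net.actionBound k + (net.actionBound k / net.r k + 1) * net.deltaCoeff k (2 * net.R k)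

theorem Network.deltaCoeff_two_mul_R_nonneg : 0 ≤ net.deltaCoeff k (2 * net.R k) :=
  net.deltaCoeff_nonneg k (by linarith [net.R_pos k])

theorem Network.reach_pos : 0 < net.reach k := by
  have := net.actionBound_pos k
  have := net.r_pos k
  have := net.deltaCoeff_two_mul_R_nonneg k
  unfold Network.reach
  positivity

/-- `lossBound * (T / t) ^ (1 / 4)` bounds the losses of all nodes in round `t`, at the decisions
of the algorithm. -/
noncomputable def Network.lossBound : ℝ := 1 + net.lip * ∑ k, net.reach k

theorem Network.lossBound_pos : 0 < net.lossBound :=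
  add_pos_of_pos_of_nonneg one_pos
    (mul_nonneg net.lip_pos.le (Finset.sum_nonneg fun k _ => (net.reach_pos k).le))

/-- `gradBound k * T ^ (1 / 4)` bounds the gradient estimates of node `k`. -/
noncomputable def Network.gradBound : ℝ := net.dim k * net.lossBound / net.deltaCoeff k 0

theorem Network.gradBound_pos {k : V} (hk : (nbhd net.graph k).Nonempty) :
    0 < net.gradBound k :=
  div_pos (mul_pos (net.dim_pos k) net.lossBound_pos) (net.deltaCoeff_zero_pos hk)

end Constants

/-! ### The experts -/

section Experts

theorem one_le_numExperts (T : ℕ) : 1 ≤ numExperts T := Nat.le_add_left _ _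

theorem priorWeight_pos {K m : ℕ} (hK : 1 ≤ K) (hm : 1 ≤ m) : 0 < priorWeight K m := by
  have : (0 : ℝ) < K := by exact_mod_cast hK
  have : (0 : ℝ) < m := by exact_mod_cast hm
  unfold priorWeight
  positivity

theorem sum_one_div_mul_add_one (K : ℕ) :
    ∑ m ∈ Finset.Icc 1 K, 1 / ((m : ℝ) * (m + 1)) = K / (K + 1) := by
  induction K with
  | zero => simp
  | succ K ih =>
    rw [Finset.sum_Icc_succ_top (by omega), ih]
    push_cast
    field_simp
    ring

theorem sum_priorWeight {K : ℕ} (hK : 1 ≤ K) : ∑ m ∈ Finset.Icc 1 K, priorWeight K m = 1 := by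
  have : (0 : ℝ) < K := by exact_mod_cast hK
  unfold priorWeight
  rw [← Finset.mul_sum, sum_one_div_mul_add_one]
  field_simp

theorem half_logb_two_le {T : ℕ} (hT : 1 ≤ T) :
    (1 / 2 : ℝ) * Real.logb 2 (1 + T) ≤ 1 + Real.log T := by
  have hT' : (1 : ℝ) ≤ T := by exact_mod_cast hT
  have hlog_two := Real.log_two_gt_d9
  have hlog_nonneg : 0 ≤ Real.log T := Real.log_nonneg hT'
  have hlog : Real.log (1 + T) ≤ Real.log 2 + Real.log T := by
    rw [← Real.log_mul (by norm_num) (by positivity)]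
    exact Real.log_le_log (by positivity) (by linarith)
  rw [Real.logb, ← mul_div_assoc, div_le_iff₀ (by linarith)]
  nlinarith

theorem numExperts_le {T : ℕ} (hT : 1 ≤ T) : (numExperts T : ℝ) ≤ 3 * (1 + Real.log T) := by
  have hlog_nonneg : 0 ≤ Real.log T := Real.log_natCast_nonneg T
  have hlogb_nonneg : 0 ≤ (1 / 2 : ℝ) * Real.logb 2 (1 + T) :=
    mul_nonneg (by norm_num) (Real.logb_nonneg one_lt_two (by simp))
  have hceil := Nat.ceil_lt_add_one hlogb_nonneg
  have hhalf := half_logb_two_le hT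
  unfold numExperts
  push_cast
  linarith

theorem log_inv_priorWeight_le {T m : ℕ} (hT : 1 ≤ T) (hm : m ∈ Finset.Icc 1 (numExperts T)) :
    Real.log (1 / priorWeight (numExperts T) m) ≤ 6 * (1 + Real.log T) := by
  obtain ⟨hm1, hmK⟩ := Finset.mem_Icc.mp hm
  have hK_le := numExperts_le hT
  set K := numExperts T
  have hm_pos : (1 : ℝ) ≤ m := by exact_mod_cast hm1
  have hm_le : (m : ℝ) ≤ K := by exact_mod_cast hmK
  have hK_pos : (0 : ℝ) < K := by linarith
  have hweight := priorWeight_pos (hm1.trans hmK) hm1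
  have hinv : 1 / priorWeight K m ≤ (K : ℝ) ^ 2 := by
    unfold priorWeight
    rw [one_div, mul_one_div, inv_div, div_le_iff₀ (by positivity),
      show (K : ℝ) ^ 2 * ((K + 1) / K) = K * (K + 1) by field_simp]
    gcongr
  calc Real.log (1 / priorWeight K m)
    _ ≤ Real.log ((K : ℝ) ^ 2) := Real.log_le_log (by positivity) hinv
    _ = 2 * Real.log K := by rw [Real.log_pow]; norm_num
    _ ≤ 2 * (K - 1) := by gcongr; exact Real.log_le_sub_one_of_pos hK_pos
    _ ≤ 6 * (1 + Real.log T) := by linarith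

theorem sqrt_le_two_pow_numExperts (T : ℕ) : √(1 + T) ≤ 2 ^ (numExperts T - 1) := by
  unfold numExperts
  rw [Nat.add_sub_cancel, ← Real.rpow_natCast]
  calc √(1 + T)
    _ = (2 : ℝ) ^ ((1 / 2 : ℝ) * Real.logb 2 (1 + T)) := by
        rw [mul_comm, Real.rpow_mul (by norm_num), Real.rpow_logb (by norm_num) (by norm_num)
          (by positivity), Real.sqrt_eq_rpow]
    _ ≤ _ := Real.rpow_le_rpow_of_exponent_le (by norm_num) (Nat.le_ceil _)

theorem exists_two_pow_le_and_le_mul {N : ℕ} {B c : ℝ} (hB : 1 ≤ B) (hc : 1 ≤ c)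
    (hBN : B ≤ c * 2 ^ N) : ∃ n ≤ N, 2 ^ n ≤ B ∧ B ≤ 2 * c * 2 ^ n := by
  classical
  set n := Nat.findGreatest (fun n => (2 : ℝ) ^ n ≤ B) N
  have hnN : n ≤ N := Nat.findGreatest_le _
  have hnB : (2 : ℝ) ^ n ≤ B :=
    Nat.findGreatest_spec (P := fun n => (2 : ℝ) ^ n ≤ B) (Nat.zero_le _) (by simpa using hB)
  refine ⟨n, hnN, hnB, ?_⟩
  rcases hnN.lt_or_eq with hlt | heq
  · have hsucc := Nat.findGreatest_is_greatest (P := fun n => (2 : ℝ) ^ n ≤ B) n.lt_succ_self hlt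
    simp only [not_le, pow_succ] at hsucc
    calc B ≤ 2 * 1 * 2 ^ n := by linarith
      _ ≤ 2 * c * 2 ^ n := by gcongr
  · calc B ≤ c * 2 ^ n := by rwa [heq]
      _ ≤ 2 * c * 2 ^ n := by gcongr; linarith

theorem mul_sq_div_mul_le {a b c A B : ℝ} (ha : 0 ≤ a) (hb : 0 < b) (hA : 0 < A) (hB : 0 ≤ B)
    (hBA : B ≤ c * A) : a * B ^ 2 / (b * A) ≤ a * c / b * B := by
  rw [div_le_iff₀ (mul_pos hb hA)]
  calc a * B ^ 2
    _ = a * B * B := by ring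
    _ ≤ a * B * (c * A) := by gcongr
    _ = a * c / b * B * (b * A) := by field_simp

/-- The best step size against a comparator of path length `P` is proportional to `√(1 + P)`. -/
theorem exists_expert {R P : ℝ} (hR : 0 ≤ R) {T : ℕ} (hP : 0 ≤ P) (hPT : P ≤ 2 * R * T) :
    ∃ m ∈ Finset.Icc 1 (numExperts T), (2 : ℝ) ^ (m - 1) ≤ √(1 + P) ∧
      √(1 + P) ≤ 2 * √(1 + 2 * R) * 2 ^ (m - 1) := by
  have hgrid : √(1 + P) ≤ √(1 + 2 * R) * 2 ^ (numExperts T - 1) :=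
    calc √(1 + P)
      _ ≤ √((1 + 2 * R) * (1 + T)) := by
          apply Real.sqrt_le_sqrt
          have : (0 : ℝ) ≤ T := by positivity
          linarith
      _ = √(1 + 2 * R) * √(1 + T) := Real.sqrt_mul (by linarith) _
      _ ≤ _ := by gcongr; exact sqrt_le_two_pow_numExperts T
  obtain ⟨n, hn, hlower, hupper⟩ := exists_two_pow_le_and_le_mul
    (Real.one_le_sqrt.mpr (by linarith)) (Real.one_le_sqrt.mpr (by linarith)) hgrid
  have := one_le_numExperts T
  exact ⟨n + 1, Finset.mem_Icc.mpr ⟨by omega, by omega⟩, by simpa using hlower,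
    by simpa using hupper⟩

end Experts

/-! ### The iterates of the algorithm -/

section Run

variable {V : Type*} [Fintype V] {net : Network V}

namespace Scenario

variable (S : Scenario net) {k : V}

theorem norm_le_actionBound {x : Alloc net.graph k} (hx : x ∈ S.action k) :
    ‖x‖ ≤ net.actionBound k := by
  have hdist := S.action_subset k hx
  rw [Metric.mem_closedBall, dist_eq_norm] at hdist
  have := norm_le_norm_add_norm_sub' x (net.center k)
  unfold Network.actionBound
  linarith

variable (k) in
theorem action_nonempty : (S.action k).Nonempty := by
  obtain ⟨c, hc⟩ := S.ball_subset k
  exact ⟨c, hc (Metric.mem_closedBall_self (net.r_pos k).le)⟩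

theorem smul_action_isClosed (a : ℝ) : IsClosed (a • S.action k) :=
  ((Metric.isCompact_of_isClosed_isBounded (S.action_closed k)
    (Metric.isBounded_closedBall.subset (S.action_subset k))).smul a).isClosed

theorem norm_sub_le {x y : Alloc net.graph k} (hx : x ∈ S.action k) (hy : y ∈ S.action k) :
    ‖x - y‖ ≤ 2 * net.R k := by
  rw [← dist_eq_norm, two_mul]
  exact (dist_triangle_right x y (net.center k)).trans
    (add_le_add (S.action_subset k hx) (S.action_subset k hy))

theorem pathLength_le {v : ℕ → Alloc net.graph k} {T : ℕ}
    (hv : ∀ t ∈ Finset.Icc 1 T, v t ∈ S.action k) : pathLength T v ≤ 2 * net.R k * T := by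
  have hstep : ∀ t ∈ Finset.Icc 2 T, ‖v t - v (t - 1)‖ ≤ 2 * net.R k := fun t ht => by
    obtain ⟨h2t, htT⟩ := Finset.mem_Icc.mp ht
    exact S.norm_sub_le (hv t (Finset.mem_Icc.mpr ⟨by omega, htT⟩))
      (hv (t - 1) (Finset.mem_Icc.mpr ⟨by omega, by omega⟩))
  have hR := net.R_pos k
  calc pathLength T v
    _ ≤ (Finset.Icc 2 T).card • (2 * net.R k) := Finset.sum_le_card_nsmul _ _ _ hstep
    _ = (Finset.Icc 2 T).card * (2 * net.R k) := nsmul_eq_mul _ _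
    _ ≤ T * (2 * net.R k) := by
        gcongr
        simp
    _ = 2 * net.R k * T := mul_comm _ _

end Scenario

variable {S : Scenario net} {I : RunInput net}

theorem state_succ (S : Scenario net) (I : RunInput net) {t : ℕ} (ht : 1 ≤ t) :
    state S I (t + 1) = nextState S I t (state S I t) := by
  obtain ⟨t, rfl⟩ := Nat.exists_eq_add_of_le' ht
  rfl

theorem state_induction {p : (∀ k, AgentState (Alloc net.graph k)) → Prop}
    (hfirst : p (firstState I)) (hnext : ∀ t s, p s → p (nextState S I t s)) (t : ℕ) :
    p (state S I t) := by
  induction t with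
  | zero => exact hfirst
  | succ t ih =>
    rcases Nat.eq_zero_or_pos t with rfl | ht
    · exact hfirst
    · rw [state_succ S I ht]
      exact hnext t _ ih

theorem nextDual_eq_zero {t : ℕ} {s : ∀ k, AgentState (Alloc net.graph k)} {k : V}
    (hgen : 0 ≤ I.gen k t) (hdual : (s k).dual = 0) : nextDual I t s k = 0 := by
  unfold nextDual
  rw [hdual, mul_zero, sub_zero, zero_add]
  refine max_eq_left (mul_nonpos_of_nonneg_of_nonpos ?_ (constr_adjust_nonpos _ hgen))
  unfold Network.gamma
  positivity

theorem state_dual (hgen : ∀ k t, 0 ≤ I.gen k t) (t : ℕ) : ∀ k, (state S I t k).dual = 0 :=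
  state_induction (p := fun s => ∀ k, (s k).dual = 0) (fun _ => rfl)
    (fun t _ ih k => nextDual_eq_zero (hgen k t) (ih k)) t

theorem updateDir_eq_gradEst (hgen : ∀ k t, 0 ≤ I.gen k t) (t : ℕ) (k : V) :
    updateDir S I t (state S I t) k = gradEst S I t (state S I t) k := by
  unfold updateDir gradEst
  rw [nextDual_eq_zero (hgen k t) (state_dual hgen t k), zero_mul, zero_smul, add_zero, smul_smul]

theorem state_weight_pos (S : Scenario net) (I : RunInput net) (t : ℕ) :
    ∀ k, ∀ m ∈ Finset.Icc 1 (numExperts I.T), 0 < (state S I t k).weight m :=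
  state_induction (p := fun s => ∀ k, ∀ m ∈ Finset.Icc 1 (numExperts I.T), 0 < (s k).weight m)
    (fun _ _ hm => priorWeight_pos (one_le_numExperts _) (Finset.mem_Icc.mp hm).1)
    (fun _ _ ih k m hm => div_pos (mul_pos (ih k m hm) (Real.exp_pos _))
      (Finset.sum_pos (fun m' hm' => mul_pos (ih k m' hm') (Real.exp_pos _)) ⟨m, hm⟩)) t

theorem sum_state_weight (S : Scenario net) (I : RunInput net) (t : ℕ) (k : V) :
    ∑ m ∈ Finset.Icc 1 (numExperts I.T), (state S I t k).weight m = 1 := by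
  have hfirst : ∑ m ∈ Finset.Icc 1 (numExperts I.T), (firstState I k).weight m = 1 :=
    sum_priorWeight (one_le_numExperts _)
  match t with
  | 0 => exact hfirst
  | 1 => exact hfirst
  | t + 2 =>
    rw [state_succ S I (by omega)]
    simp only [nextState]
    rw [← Finset.sum_div]
    refine div_self (Finset.sum_pos (fun m hm =>
      mul_pos (state_weight_pos S I (t + 1) k m hm) (Real.exp_pos _)) ?_).ne'
    exact ⟨1, Finset.mem_Icc.mpr ⟨le_rfl, one_le_numExperts _⟩⟩

variable (S I) in
/-- The standing assumptions on the data of a run. Path-length values are bounded as for sequences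
of `T` actions. -/
structure Admissible : Prop where
  one_le_horizon : 1 ≤ I.T
  p_nonneg : ∀ k, 0 ≤ I.p k
  p_le : ∀ k, I.p k ≤ 2 * net.R k * I.T
  gen_nonneg : ∀ k t, 0 ≤ I.gen k t
  norm_dir : ∀ k t, ‖I.dir k t‖ = 1
  start_mem : ∀ k, I.start k ∈ (1 - net.xi k (I.p k) 1) • S.action k

namespace Admissible

variable (hI : Admissible S I) {k : V} {t : ℕ}

include hI

theorem expert_mem (ht : 1 ≤ t) (k : V) (m : ℕ) :
    (state S I t k).expert m ∈ (1 - net.xi k (I.p k) t) • S.action k := by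
  induction t, ht using Nat.le_induction with
  | base => exact hI.start_mem k
  | succ t ht _ =>
    rw [state_succ S I ht]
    exact (proj_spec (S.action_nonempty k).smul_set (S.smul_action_isClosed _)
      ((S.action_convex k).smul _) _).1

theorem combine_mem (ht : 1 ≤ t) (k : V) :
    combine I k (state S I t k) ∈ (1 - net.xi k (I.p k) t) • S.action k :=
  ((S.action_convex k).smul _).sum_mem (fun m hm => (state_weight_pos S I t k m hm).le)
    (sum_state_weight S I t k) fun m _ => hI.expert_mem ht k m

theorem delta_nonneg (k : V) (t : ℕ) : 0 ≤ net.delta k (I.p k) t := by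
  rw [net.delta_eq k (hI.p_nonneg k)]
  exact div_nonneg (net.deltaCoeff_nonneg k (hI.p_nonneg k)) (fourthRoot_nonneg t)

theorem delta_pos (hk : (nbhd net.graph k).Nonempty) (ht : 1 ≤ t) :
    0 < net.delta k (I.p k) t := by
  rw [net.delta_eq k (hI.p_nonneg k)]
  exact div_pos ((net.deltaCoeff_zero_pos hk).trans_le
    (net.deltaCoeff_zero_le k (hI.p_nonneg k))) (fourthRoot_pos ht)

theorem delta_le (k : V) (t : ℕ) :
    net.delta k (I.p k) t ≤ net.deltaCoeff k (2 * net.R k) * (fourthRoot I.T / fourthRoot t) := by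
  rw [net.delta_eq k (hI.p_nonneg k), ← mul_div_assoc]
  have := fourthRoot_nonneg t
  gcongr
  exact net.deltaCoeff_le_mul_fourthRoot k (hI.p_nonneg k) hI.one_le_horizon (hI.p_le k)

theorem xi_nonneg (k : V) (t : ℕ) : 0 ≤ net.xi k (I.p k) t :=
  div_nonneg (hI.delta_nonneg k t) (net.r_pos k).le

theorem norm_add_delta_le (ht : t ∈ Finset.Icc 1 I.T) {x : Alloc net.graph k} {a : ℝ}
    (ha : |a| ≤ 1 + net.xi k (I.p k) t) (hx : x ∈ a • S.action k) :
    ‖x‖ + net.delta k (I.p k) t ≤ net.reach k * (fourthRoot I.T / fourthRoot t) := by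
  obtain ⟨y, hy, rfl⟩ := hx
  obtain ⟨h1t, htT⟩ := Finset.mem_Icc.mp ht
  have hr := net.r_pos k
  have hM := net.actionBound_pos k
  have hratio := one_le_fourthRoot_div h1t htT
  have hξ := hI.xi_nonneg k t
  calc ‖a • y‖ + net.delta k (I.p k) t
    _ ≤ (1 + net.xi k (I.p k) t) * net.actionBound k + net.delta k (I.p k) t := by
        rw [norm_smul, Real.norm_eq_abs]
        gcongr
        exact S.norm_le_actionBound hy
    _ = net.actionBound k * 1 + (net.actionBound k / net.r k + 1) * net.delta k (I.p k) t := by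
        unfold Network.xi
        ring
    _ ≤ net.actionBound k * (fourthRoot I.T / fourthRoot t)
          + (net.actionBound k / net.r k + 1) *
            (net.deltaCoeff k (2 * net.R k) * (fourthRoot I.T / fourthRoot t)) := by
        gcongr
        exact hI.delta_le k t
    _ = net.reach k * (fourthRoot I.T / fourthRoot t) := by
        unfold Network.reach
        ring

theorem norm_add_delta_le_of_mem_shrunk (ht : t ∈ Finset.Icc 1 I.T) {x : Alloc net.graph k}
    (hx : x ∈ (1 - net.xi k (I.p k) t) • S.action k) :
    ‖x‖ + net.delta k (I.p k) t ≤ net.reach k * (fourthRoot I.T / fourthRoot t) := by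
  have hξ := hI.xi_nonneg k t
  exact hI.norm_add_delta_le ht (abs_le.mpr ⟨by linarith, by linarith⟩) hx

theorem norm_le_of_mem_shrunk (ht : t ∈ Finset.Icc 1 I.T) {x : Alloc net.graph k}
    (hx : x ∈ (1 - net.xi k (I.p k) t) • S.action k) :
    ‖x‖ ≤ net.reach k * (fourthRoot I.T / fourthRoot t) := by
  linarith [hI.norm_add_delta_le_of_mem_shrunk ht hx, hI.delta_nonneg k t]

theorem norm_decision_le (ht : t ∈ Finset.Icc 1 I.T) (k : V) :
    ‖decision S I k t‖ ≤ net.reach k * (fourthRoot I.T / fourthRoot t) := by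
  refine (norm_add_le _ _).trans ?_
  rw [norm_smul, hI.norm_dir, mul_one, Real.norm_of_nonneg (hI.delta_nonneg k t)]
  exact hI.norm_add_delta_le_of_mem_shrunk ht (hI.combine_mem (Finset.mem_Icc.mp ht).1 k)

theorem abs_roundLoss_le (ht : t ∈ Finset.Icc 1 I.T) {x : Alloc net.graph k}
    (hx : ‖x‖ ≤ net.reach k * (fourthRoot I.T / fourthRoot t)) :
    |roundLoss S I k t x| ≤ net.lossBound * (fourthRoot I.T / fourthRoot t) := by
  classical
  set y := Function.update (fun j => adjust (decision S I j t) (I.gen j t)) k x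
  set ρ := fourthRoot I.T / fourthRoot t
  have hy : ∀ j, ‖y j‖ ≤ net.reach j * ρ := by
    intro j
    by_cases hjk : j = k
    · subst hjk
      simpa [y] using hx
    · simp only [y, Function.update_of_ne hjk]
      exact (norm_adjust_le _ (hI.gen_nonneg j t)).trans (hI.norm_decision_le ht j)
  obtain ⟨h1t, htT⟩ := Finset.mem_Icc.mp ht
  have hlip := net.lip_pos
  calc |roundLoss S I k t x|
    _ = loss (fun j => S.demand j t) y k := abs_of_nonneg (loss_nonneg _ _ _)
    _ ≤ 1 + net.lip * ∑ j, ‖y j‖ := loss_le net.minDemand_pos (fun j => S.demand_ge j t) y k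
    _ ≤ ρ + net.lip * ∑ j, net.reach j * ρ := by
        gcongr with j
        · exact one_le_fourthRoot_div h1t htT
        · exact hy j
    _ = net.lossBound * ρ := by
        rw [Network.lossBound, ← Finset.sum_mul]
        ring

theorem norm_gradEst_le (ht : t ∈ Finset.Icc 1 I.T) (hk : (nbhd net.graph k).Nonempty) :
    ‖gradEst S I t (state S I t) k‖ ≤ net.gradBound k * fourthRoot I.T := by
  have hroot := fourthRoot_pos (Finset.mem_Icc.mp ht).1
  have hcoeff_zero := net.deltaCoeff_zero_pos hk
  have hcoeff := net.deltaCoeff_zero_le k (hI.p_nonneg k)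
  have hdim := net.dim_pos k
  have hloss := net.lossBound_pos
  have hT := fourthRoot_nonneg I.T
  have hδ := hI.delta_nonneg k t
  calc ‖gradEst S I t (state S I t) k‖
    _ = net.dim k / net.delta k (I.p k) t * |roundLoss S I k t (decision S I k t)| := by
        rw [gradEst, norm_smul, hI.norm_dir, mul_one, Real.norm_eq_abs, abs_mul,
          abs_of_nonneg (by positivity)]
        rfl
    _ ≤ net.dim k / net.delta k (I.p k) t *
          (net.lossBound * (fourthRoot I.T / fourthRoot t)) := by
        gcongr
        exact hI.abs_roundLoss_le ht (hI.norm_decision_le ht k)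
    _ = net.dim k * net.lossBound / net.deltaCoeff k (I.p k) * fourthRoot I.T := by
        rw [net.delta_eq k (hI.p_nonneg k)]
        field_simp
    _ ≤ net.gradBound k * fourthRoot I.T := by
        unfold Network.gradBound
        gcongr

end Admissible

theorem abs_roundLoss_sub_le (S : Scenario net) (I : RunInput net) (k : V) (t : ℕ)
    (x x' : Alloc net.graph k) :
    |roundLoss S I k t x - roundLoss S I k t x'| ≤ net.lip * ‖x - x'‖ :=
  abs_loss_update_sub_le net.minDemand_pos (fun j => S.demand_ge j t) _ k x x'

end Run

/-! ### The regret along a run -/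

section Regret

variable {V : Type*} [Fintype V] {net : Network V}

/-- The constant factor of the step sizes, without the factor `2 ^ (m - 1)` of expert `m` and the
decay `t ^ (-3/4)`. -/
noncomputable def Network.stepConst (net : Network V) (k : V) : ℝ :=
  √(2 * net.R k ^ 3 / (2 * net.deg k * net.F k * net.lipTilde k))

theorem Network.stepConst_pos (net : Network V) {k : V} (hk : (nbhd net.graph k).Nonempty) :
    0 < net.stepConst k := by
  have := net.R_pos k
  have := net.deg_pos hk
  have := net.F_pos k
  have := net.lipTilde_pos k
  unfold Network.stepConst
  positivity

theorem Network.eta_eq (net : Network V) (k : V) (m t : ℕ) :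
    net.eta k m t = net.stepConst k * 2 ^ (m - 1) / fourthRoot t ^ 3 := by
  rw [Network.eta, Network.stepConst, rpow_neg_three_quarters, mul_one_div,
    mul_comm (2 ^ (m - 1) : ℝ)]

/-- A bound of the norms of iterates and shrunk comparators of node `k` and of the variation of the
latter, relative to powers of `T ^ (1 / 4)` and `t ^ (1 / 4)`. -/
noncomputable def Network.span (net : Network V) (k : V) : ℝ :=
  net.reach k + 1 + net.deltaCoeff k (2 * net.R k) / net.r k

theorem Network.reach_le_span (net : Network V) (k : V) : net.reach k ≤ net.span k := by
  have := div_nonneg (net.deltaCoeff_two_mul_R_nonneg k) (net.r_pos k).le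
  unfold Network.span
  linarith

/-- The comparator `v t`, shrunk into the decision set of round `t + 1`. -/
noncomputable def shrunk (I : RunInput net) (k : V) (v : ℕ → Alloc net.graph k) (t : ℕ) :
    Alloc net.graph k :=
  (1 - net.xi k (I.p k) (t + 1)) • v t

/-- The amount by which the gradient estimate at the combined point fails the subgradient
inequality at the shrunk comparator. -/
noncomputable def subgradientGap (S : Scenario net) (I : RunInput net) (k : V)
    (v : ℕ → Alloc net.graph k) (t : ℕ) : ℝ :=
  roundLoss S I k t (combine I k (state S I t k)) - roundLoss S I k t (shrunk I k v t) -
    inner ℝ (gradEst S I t (state S I t) k) (combine I k (state S I t k) - shrunk I k v t)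

variable {S : Scenario net} {I : RunInput net}

theorem sum_weight_mul_surrogate {t : ℕ} {s : ∀ k, AgentState (Alloc net.graph k)} {k : V}
    (hs : ∑ m ∈ Finset.Icc 1 (numExperts I.T), (s k).weight m = 1) :
    ∑ m ∈ Finset.Icc 1 (numExperts I.T),
      (s k).weight m * surrogate S I t s k ((s k).expert m) = 0 := by
  simp only [surrogate, ← inner_smul_right, ← inner_sum, smul_sub, Finset.sum_sub_distrib,
    ← Finset.sum_smul, hs, one_smul]
  rw [← combine, sub_self, inner_zero_right]

namespace Admissible

variable (hI : Admissible S I) {k : V} {v : ℕ → Alloc net.graph k} {t : ℕ}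

include hI

theorem xi_succ_le (k : V) (ht : 1 ≤ t) : net.xi k (I.p k) (t + 1) ≤ net.xi k (I.p k) t := by
  have := net.deltaCoeff_nonneg k (hI.p_nonneg k)
  have := net.r_pos k
  have := fourthRoot_pos ht
  have := fourthRoot_mono t.le_succ
  rw [Network.xi, Network.xi, net.delta_eq k (hI.p_nonneg k), net.delta_eq k (hI.p_nonneg k)]
  gcongr

theorem xi_le (k : V) (t : ℕ) : net.xi k (I.p k) t ≤
    net.deltaCoeff k (2 * net.R k) / net.r k * (fourthRoot I.T / fourthRoot t) := by
  have := net.r_pos k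
  rw [Network.xi, div_mul_eq_mul_div]
  gcongr
  exact hI.delta_le k t

theorem xi_sub_le (k : V) (ht : 1 ≤ t) : net.xi k (I.p k) t - net.xi k (I.p k) (t + 1) ≤
    net.deltaCoeff k (2 * net.R k) / net.r k * (fourthRoot I.T / fourthRoot t ^ 5) := by
  have hr := net.r_pos k
  have hroot := fourthRoot_pos ht
  have hp := hI.p_nonneg k
  have hcoeff := net.deltaCoeff_nonneg k hp
  calc net.xi k (I.p k) t - net.xi k (I.p k) (t + 1)
    _ = net.deltaCoeff k (I.p k) / net.r k * (1 / fourthRoot t - 1 / fourthRoot (t + 1)) := by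
        rw [Network.xi, Network.xi, net.delta_eq k hp, net.delta_eq k hp]
        ring
    _ ≤ net.deltaCoeff k (I.p k) / net.r k * (1 / fourthRoot t ^ 5) := by
        gcongr
        exact inv_fourthRoot_sub_le ht
    _ ≤ net.deltaCoeff k (2 * net.R k) * fourthRoot I.T / net.r k * (1 / fourthRoot t ^ 5) := by
        gcongr
        exact net.deltaCoeff_le_mul_fourthRoot k hp hI.one_le_horizon (hI.p_le k)
    _ = _ := by ring

theorem norm_shrunk_le (ht : t ∈ Finset.Icc 1 I.T) (hv : v t ∈ S.action k) :
    ‖shrunk I k v t‖ ≤ net.reach k * (fourthRoot I.T / fourthRoot t) := by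
  have hξ := hI.xi_nonneg k (t + 1)
  have hξ_succ := hI.xi_succ_le k (Finset.mem_Icc.mp ht).1
  have hbound := hI.norm_add_delta_le ht (abs_le.mpr ⟨by linarith, by linarith⟩)
    (Set.smul_mem_smul_set (a := 1 - net.xi k (I.p k) (t + 1)) hv)
  exact (le_add_of_nonneg_right (hI.delta_nonneg k t)).trans hbound

theorem norm_shrunk_succ_sub_le (ht : 1 ≤ t) (htT : t + 1 ≤ I.T) (hv : v t ∈ S.action k) :
    ‖shrunk I k v (t + 1) - shrunk I k v t‖ ≤
      net.span k * (fourthRoot I.T / fourthRoot (t + 1)) * ‖v (t + 1) - v t‖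
        + net.span k * (fourthRoot I.T / fourthRoot (t + 1) ^ 5) := by
  have hsucc : 1 ≤ t + 1 := by omega
  have hroot := fourthRoot_pos hsucc
  have hT := fourthRoot_nonneg I.T
  have hratio := one_le_fourthRoot_div hsucc htT
  have hr := net.r_pos k
  have hcoeff := net.deltaCoeff_two_mul_R_nonneg k
  have hcoeff_div := div_nonneg hcoeff hr.le
  have hreach := net.reach_pos k
  have hM := net.actionBound_pos k
  set ξ := net.xi k (I.p k) (t + 1)
  set ξ' := net.xi k (I.p k) (t + 1 + 1)
  have hξ' : 0 ≤ ξ' := hI.xi_nonneg k _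
  have hξ'ξ : ξ' ≤ ξ := hI.xi_succ_le k hsucc
  have hfactor : |1 - ξ'| ≤ net.span k * (fourthRoot I.T / fourthRoot (t + 1)) := by
    have hξ : ξ ≤ _ := hI.xi_le k (t + 1)
    have : 0 ≤ net.reach k * (fourthRoot I.T / fourthRoot (t + 1)) := by positivity
    unfold Network.span
    exact abs_le.mpr ⟨by linarith, by linarith⟩
  have hdrift : |ξ - ξ'| * ‖v t‖ ≤ net.span k * (fourthRoot I.T / fourthRoot (t + 1) ^ 5) := by
    rw [abs_of_nonneg (sub_nonneg.mpr hξ'ξ)]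
    calc (ξ - ξ') * ‖v t‖
      _ ≤ net.deltaCoeff k (2 * net.R k) / net.r k * (fourthRoot I.T / fourthRoot (t + 1) ^ 5) *
            net.actionBound k := by
          gcongr
          · exact hI.xi_sub_le k hsucc
          · exact S.norm_le_actionBound hv
      _ = net.actionBound k / net.r k * net.deltaCoeff k (2 * net.R k) *
            (fourthRoot I.T / fourthRoot (t + 1) ^ 5) := by ring
      _ ≤ _ := by
          gcongr
          unfold Network.span Network.reach
          linarith
  calc ‖shrunk I k v (t + 1) - shrunk I k v t‖
    _ = ‖(1 - ξ') • (v (t + 1) - v t) + (ξ - ξ') • v t‖ := by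
        congr 1
        unfold shrunk
        module
    _ ≤ |1 - ξ'| * ‖v (t + 1) - v t‖ + |ξ - ξ'| * ‖v t‖ := by
        refine (norm_add_le _ _).trans_eq ?_
        rw [norm_smul, norm_smul, Real.norm_eq_abs, Real.norm_eq_abs]
    _ ≤ _ := by gcongr

theorem sum_delta_le {P : ℝ} (hP : I.p k ≤ P) :
    ∑ t ∈ Finset.Icc 1 I.T, net.delta k (I.p k) t ≤
      4 * net.deltaCoeff k 1 * (fourthRoot I.T ^ 3 * √(1 + P)) := by
  have hcoeff := net.deltaCoeff_nonneg k (hI.p_nonneg k)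
  have hcoeff_le := net.deltaCoeff_le_mul_sqrt k (hI.p_nonneg k) hP
  have := fourthRoot_nonneg I.T
  have hterm : ∀ t ∈ Finset.Icc 1 I.T, net.delta k (I.p k) t ≤
      net.deltaCoeff k (I.p k) * fourthRoot I.T ^ 2 * (1 / fourthRoot t ^ 3) := by
    intro t ht
    have hroot := fourthRoot_pos (Finset.mem_Icc.mp ht).1
    calc net.delta k (I.p k) t
      _ = net.deltaCoeff k (I.p k) * fourthRoot t ^ 2 * (1 / fourthRoot t ^ 3) := by
          rw [net.delta_eq k (hI.p_nonneg k)]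
          field_simp
      _ ≤ _ := by
          gcongr
          exact fourthRoot_mono (Finset.mem_Icc.mp ht).2
  calc ∑ t ∈ Finset.Icc 1 I.T, net.delta k (I.p k) t
    _ ≤ net.deltaCoeff k (I.p k) * fourthRoot I.T ^ 2 *
          ∑ t ∈ Finset.Icc 1 I.T, 1 / fourthRoot t ^ 3 := by
        rw [Finset.mul_sum]
        exact Finset.sum_le_sum hterm
    _ ≤ net.deltaCoeff k 1 * √(1 + P) * fourthRoot I.T ^ 2 * (4 * fourthRoot I.T) := by
        have hnonneg := Finset.sum_nonneg fun t (_ : t ∈ Finset.Icc 1 I.T) =>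
          one_div_nonneg.mpr (pow_nonneg (fourthRoot_nonneg t) 3)
        gcongr ?_ * _ * ?_
        · exact mul_nonneg (hcoeff.trans hcoeff_le) (sq_nonneg _)
        · exact sum_inv_fourthRoot_cube_le _
    _ = _ := by ring

theorem abs_surrogate_expert_le (hk : (nbhd net.graph k).Nonempty) (ht : t ∈ Finset.Icc 1 I.T)
    (m : ℕ) :
    |surrogate S I t (state S I t) k ((state S I t k).expert m)| ≤
      net.gradBound k * fourthRoot I.T *
        (2 * (net.reach k * (fourthRoot I.T / fourthRoot t))) := by
  have h1t := (Finset.mem_Icc.mp ht).1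
  have hexpert := hI.norm_le_of_mem_shrunk ht (hI.expert_mem h1t k m)
  have hcombine := hI.norm_le_of_mem_shrunk ht (hI.combine_mem h1t k)
  refine (abs_real_inner_le_norm _ _).trans (mul_le_mul (hI.norm_gradEst_le ht hk)
    ((norm_sub_le _ _).trans (by linarith)) (norm_nonneg _)
    (mul_nonneg (net.gradBound_pos hk).le (fourthRoot_nonneg _)))

theorem meta_regret_le (hk : (nbhd net.graph k).Nonempty) (hε : I.ε k = 1 / fourthRoot I.T ^ 3)
    {m : ℕ} (hm : m ∈ Finset.Icc 1 (numExperts I.T)) :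
    ∑ t ∈ Finset.Icc 1 I.T, inner ℝ (gradEst S I t (state S I t) k)
        (combine I k (state S I t k) - (state S I t k).expert m) ≤
      6 * (1 + Real.log I.T) * fourthRoot I.T ^ 3
        + 8 * net.gradBound k ^ 2 * net.reach k ^ 2 * fourthRoot I.T ^ 3 := by
  set τ := fourthRoot I.T
  have hτ : 0 < τ := fourthRoot_pos hI.one_le_horizon
  have hregret := exponential_weights_regret (ε := I.ε k)
    (ω := fun t => (state S I t k).weight)
    (ℓ := fun t m => surrogate S I t (state S I t) k ((state S I t k).expert m))
    (by rw [hε]; positivity) (fun t => state_weight_pos S I t k) (fun t => sum_state_weight S I t k)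
    (fun t ht m => by rw [state_succ S I ht]; rfl)
    (fun t _ => sum_weight_mul_surrogate (sum_state_weight S I t k))
    (fun t ht m _ => hI.abs_surrogate_expert_le hk ht m) hm
  have hprior : Real.log (1 / (state S I 1 k).weight m) / I.ε k ≤
      6 * (1 + Real.log I.T) * τ ^ 3 := by
    rw [hε, div_div_eq_mul_div, div_one]
    gcongr
    exact log_inv_priorWeight_le hI.one_le_horizon hm
  have hvariance : ∀ t ∈ Finset.Icc 1 I.T,
      I.ε k * (net.gradBound k * τ * (2 * (net.reach k * (τ / fourthRoot t)))) ^ 2 / 2 ≤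
        2 * net.gradBound k ^ 2 * net.reach k ^ 2 * τ ^ 2 * (1 / fourthRoot t ^ 3) := by
    intro t ht
    obtain ⟨h1t, htT⟩ := Finset.mem_Icc.mp ht
    have hroot := fourthRoot_pos h1t
    calc _ = 2 * net.gradBound k ^ 2 * net.reach k ^ 2 * (τ * fourthRoot t) *
            (1 / fourthRoot t ^ 3) := by
          rw [hε]
          field_simp
      _ ≤ _ := by
          rw [sq τ]
          gcongr
          exact fourthRoot_mono htT
  calc ∑ t ∈ Finset.Icc 1 I.T, inner ℝ (gradEst S I t (state S I t) k)
        (combine I k (state S I t k) - (state S I t k).expert m)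
    _ = -∑ t ∈ Finset.Icc 1 I.T, surrogate S I t (state S I t) k ((state S I t k).expert m) := by
        simp only [surrogate, ← Finset.sum_neg_distrib, ← inner_neg_right, neg_sub]
    _ ≤ 6 * (1 + Real.log I.T) * τ ^ 3 + 2 * net.gradBound k ^ 2 * net.reach k ^ 2 * τ ^ 2 *
          ∑ t ∈ Finset.Icc 1 I.T, 1 / fourthRoot t ^ 3 := by
        rw [Finset.mul_sum]
        exact hregret.trans (add_le_add hprior (Finset.sum_le_sum hvariance))
    _ ≤ 6 * (1 + Real.log I.T) * τ ^ 3 + 2 * net.gradBound k ^ 2 * net.reach k ^ 2 * τ ^ 2 *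
          (4 * τ) := by
        gcongr
        exact sum_inv_fourthRoot_cube_le _
    _ = _ := by ring

theorem expert_regret_le (hk : (nbhd net.graph k).Nonempty)
    (hv : ∀ t ∈ Finset.Icc 1 I.T, v t ∈ S.action k) (m : ℕ) :
    ∑ t ∈ Finset.Icc 1 I.T, inner ℝ (gradEst S I t (state S I t) k)
        ((state S I t k).expert m - shrunk I k v t) ≤
      20 * net.span k ^ 2 * fourthRoot I.T ^ 3 * (1 + pathLength I.T v) /
          (net.stepConst k * 2 ^ (m - 1))
        + 2 * (net.stepConst k * 2 ^ (m - 1)) * net.gradBound k ^ 2 * fourthRoot I.T ^ 3 := by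
  have hstep := net.stepConst_pos hk
  have hspan := net.reach_le_span k
  have hreach_le : ∀ t, net.reach k * (fourthRoot I.T / fourthRoot t) ≤
      net.span k * (fourthRoot I.T / fourthRoot t) := fun t =>
    mul_le_mul_of_nonneg_right hspan (div_nonneg (fourthRoot_nonneg _) (fourthRoot_nonneg _))
  refine online_gradient_descent_regret hI.one_le_horizon (by positivity)
    ((net.reach_pos k).le.trans hspan) (fun t ht => ?_)
    (fun t ht => (hI.norm_le_of_mem_shrunk ht
      (hI.expert_mem (Finset.mem_Icc.mp ht).1 k m)).trans (hreach_le t))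
    (fun t ht => (hI.norm_shrunk_le ht (hv t ht)).trans (hreach_le t))
    (fun t ht => hI.norm_gradEst_le ht hk) (fun t ht => ?_)
  · rw [state_succ S I (Finset.mem_Icc.mp ht).1, ← net.eta_eq, ← updateDir_eq_gradEst hI.gen_nonneg]
    exact norm_proj_sub_le (S.action_nonempty k).smul_set (S.smul_action_isClosed _)
      ((S.action_convex k).smul _) _ (Set.smul_mem_smul_set (hv t ht))
  · obtain ⟨h2t, htT⟩ := Finset.mem_Icc.mp ht
    obtain ⟨s, rfl⟩ : ∃ s, t = s + 1 := ⟨t - 1, by omega⟩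
    exact hI.norm_shrunk_succ_sub_le (by omega) htT
      (hv s (Finset.mem_Icc.mpr ⟨by omega, by omega⟩))

end Admissible

/-- The constant in the bound of the linearized regret against shrunk comparators. -/
noncomputable def Network.trackingConst (net : Network V) (k : V) : ℝ :=
  6 + 8 * net.gradBound k ^ 2 * net.reach k ^ 2
    + 20 * net.span k ^ 2 * (2 * √(1 + 2 * net.R k)) / net.stepConst k
    + 2 * net.stepConst k * net.gradBound k ^ 2

namespace Admissible

variable (hI : Admissible S I) {k : V} {v : ℕ → Alloc net.graph k} {t : ℕ}

include hI

theorem tracking_regret_le_of_expert (hk : (nbhd net.graph k).Nonempty)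
    (hv : ∀ t ∈ Finset.Icc 1 I.T, v t ∈ S.action k) (hε : I.ε k = 1 / fourthRoot I.T ^ 3)
    {m : ℕ} (hm : m ∈ Finset.Icc 1 (numExperts I.T)) :
    ∑ t ∈ Finset.Icc 1 I.T, inner ℝ (gradEst S I t (state S I t) k)
        (combine I k (state S I t k) - shrunk I k v t) ≤
      6 * (1 + Real.log I.T) * fourthRoot I.T ^ 3
        + 8 * net.gradBound k ^ 2 * net.reach k ^ 2 * fourthRoot I.T ^ 3
        + (20 * net.span k ^ 2 * fourthRoot I.T ^ 3 * (1 + pathLength I.T v) /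
            (net.stepConst k * 2 ^ (m - 1))
          + 2 * (net.stepConst k * 2 ^ (m - 1)) * net.gradBound k ^ 2 * fourthRoot I.T ^ 3) := by
  refine le_of_eq_of_le ?_ (add_le_add (hI.meta_regret_le hk hε hm) (hI.expert_regret_le hk hv m))
  rw [← Finset.sum_add_distrib]
  refine Finset.sum_congr rfl fun t _ => ?_
  rw [← inner_add_right, sub_add_sub_cancel]

theorem tracking_regret_le (hk : (nbhd net.graph k).Nonempty)
    (hv : ∀ t ∈ Finset.Icc 1 I.T, v t ∈ S.action k) (hε : I.ε k = 1 / fourthRoot I.T ^ 3) :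
    ∑ t ∈ Finset.Icc 1 I.T, inner ℝ (gradEst S I t (state S I t) k)
        (combine I k (state S I t k) - shrunk I k v t) ≤
      net.trackingConst k * ((1 + Real.log I.T) *
        (fourthRoot I.T ^ 3 * √(1 + pathLength I.T v))) := by
  have hP := pathLength_nonneg I.T v
  obtain ⟨m, hm, hlower, hupper⟩ := exists_expert (net.R_pos k).le hP (S.pathLength_le hv)
  refine (hI.tracking_regret_le_of_expert hk hv hε hm).trans ?_
  set P := pathLength I.T v
  set B := √(1 + P)
  set τ := fourthRoot I.T
  set logFactor := 1 + Real.log I.T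
  set A : ℝ := 2 ^ (m - 1)
  have hA : 0 < A := by positivity
  have hB : 1 ≤ B := Real.one_le_sqrt.mpr (by linarith)
  have hB_sq : 1 + P = B ^ 2 := (Real.sq_sqrt (by linarith)).symm
  have hτ : 0 < τ := fourthRoot_pos hI.one_le_horizon
  have hlog : 1 ≤ logFactor := by linarith [Real.log_natCast_nonneg I.T]
  have hstep := net.stepConst_pos hk
  have hscale : τ ^ 3 * B ≤ logFactor * (τ ^ 3 * B) := le_mul_of_one_le_left (by positivity) hlog
  have hτB : τ ^ 3 ≤ τ ^ 3 * B := le_mul_of_one_le_right (by positivity) hB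
  have hslow : 20 * net.span k ^ 2 * τ ^ 3 * (1 + P) / (net.stepConst k * A) ≤
      20 * net.span k ^ 2 * (2 * √(1 + 2 * net.R k)) / net.stepConst k * (τ ^ 3 * B) := by
    rw [hB_sq]
    exact (mul_sq_div_mul_le (by positivity) hstep hA (zero_le_one.trans hB) hupper).trans_eq
      (by ring)
  have hfast := (mul_le_mul_of_nonneg_left hlower (by positivity : 0 ≤ τ ^ 3)).trans hscale
  calc _ = 6 * (logFactor * τ ^ 3) + 8 * net.gradBound k ^ 2 * net.reach k ^ 2 * τ ^ 3
          + 20 * net.span k ^ 2 * τ ^ 3 * (1 + P) / (net.stepConst k * A)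
          + 2 * net.stepConst k * net.gradBound k ^ 2 * (τ ^ 3 * A) := by ring
    _ ≤ 6 * (logFactor * (τ ^ 3 * B))
          + 8 * net.gradBound k ^ 2 * net.reach k ^ 2 * (logFactor * (τ ^ 3 * B))
          + 20 * net.span k ^ 2 * (2 * √(1 + 2 * net.R k)) / net.stepConst k *
            (logFactor * (τ ^ 3 * B))
          + 2 * net.stepConst k * net.gradBound k ^ 2 * (logFactor * (τ ^ 3 * B)) := by
        refine add_le_add (add_le_add (add_le_add ?_ ?_) (hslow.trans ?_)) ?_
        · gcongr
        · exact mul_le_mul_of_nonneg_left (hτB.trans hscale) (by positivity)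
        · exact mul_le_mul_of_nonneg_left hscale (by positivity)
        · exact mul_le_mul_of_nonneg_left hfast (by positivity)
    _ = _ := by
        unfold Network.trackingConst
        ring

theorem norm_shrunk_sub_le (ht : 1 ≤ t) (hv : v t ∈ S.action k) :
    ‖shrunk I k v t - v t‖ ≤ net.actionBound k / net.r k * net.delta k (I.p k) t :=
  calc ‖shrunk I k v t - v t‖
    _ = ‖net.xi k (I.p k) (t + 1) • v t‖ := by
        rw [← norm_neg, shrunk]
        congr 1
        module
    _ = net.xi k (I.p k) (t + 1) * ‖v t‖ := by
        rw [norm_smul, Real.norm_of_nonneg (hI.xi_nonneg k _)]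
    _ ≤ net.xi k (I.p k) t * net.actionBound k :=
        mul_le_mul (hI.xi_succ_le k ht) (S.norm_le_actionBound hv) (norm_nonneg _)
          (hI.xi_nonneg k t)
    _ = net.actionBound k / net.r k * net.delta k (I.p k) t := by
        unfold Network.xi
        ring

theorem roundLoss_decision_sub_le (ht : 1 ≤ t) (hv : v t ∈ S.action k) :
    roundLoss S I k t (decision S I k t) - roundLoss S I k t (v t) ≤
      subgradientGap S I k v t
        + net.lip * (1 + net.actionBound k / net.r k) * net.delta k (I.p k) t
        + inner ℝ (gradEst S I t (state S I t) k)
          (combine I k (state S I t k) - shrunk I k v t) := by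
  have hperturb : ‖decision S I k t - combine I k (state S I t k)‖ = net.delta k (I.p k) t := by
    rw [decision, perturb, add_sub_cancel_left, norm_smul, hI.norm_dir, mul_one,
      Real.norm_of_nonneg (hI.delta_nonneg k t)]
  have hdecision := le_of_abs_le (abs_roundLoss_sub_le S I k t (decision S I k t)
    (combine I k (state S I t k)))
  have hshrunk := le_of_abs_le (abs_roundLoss_sub_le S I k t (shrunk I k v t) (v t))
  have hnorm := mul_le_mul_of_nonneg_left (hI.norm_shrunk_sub_le ht hv) net.lip_pos.le
  rw [hperturb] at hdecision
  unfold subgradientGap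
  linarith

theorem dynRegret_le (hk : (nbhd net.graph k).Nonempty)
    (hv : ∀ t ∈ Finset.Icc 1 I.T, v t ∈ S.action k) (hε : I.ε k = 1 / fourthRoot I.T ^ 3) :
    dynRegret S I k v ≤ ∑ t ∈ Finset.Icc 1 I.T, subgradientGap S I k v t
        + (net.lip * (1 + net.actionBound k / net.r k) * ∑ t ∈ Finset.Icc 1 I.T,
            net.delta k (I.p k) t
          + net.trackingConst k * ((1 + Real.log I.T) *
            (fourthRoot I.T ^ 3 * √(1 + pathLength I.T v)))) := by
  unfold dynRegret
  rw [← Finset.sum_sub_distrib]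
  refine (Finset.sum_le_sum fun t ht =>
    hI.roundLoss_decision_sub_le (Finset.mem_Icc.mp ht).1 (hv t ht)).trans ?_
  rw [Finset.sum_add_distrib, Finset.sum_add_distrib, ← Finset.mul_sum, add_assoc]
  gcongr
  exact hI.tracking_regret_le hk hv hε

end Admissible

end Regret

/-! ### Measurability of the run -/

section Measurability

variable {V : Type*} [Fintype V]

section Allocations

variable {Θ : Type*} [MeasurableSpace Θ] {Gr : SimpleGraph V} {k : V} {x : Θ → Alloc Gr k}
  {d : Θ → ℝ}

theorem measurable_alloc_apply (hx : Measurable x) (j : closedNbhd Gr k) :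
    Measurable fun θ => x θ j :=
  (by fun_prop : Continuous fun y : Alloc Gr k => y j).measurable.comp hx

theorem measurable_alloc_sum (hx : Measurable x) : Measurable fun θ => ∑ j, x θ j :=
  Finset.measurable_fun_sum _ fun j _ => measurable_alloc_apply hx j

theorem measurable_constr (hx : Measurable x) (hd : Measurable d) :
    Measurable fun θ => constr (x θ) (d θ) :=
  (measurable_alloc_sum hx).sub hd

theorem measurable_adjust (hx : Measurable x) (hd : Measurable d) :
    Measurable fun θ => adjust (x θ) (d θ) :=
  Measurable.ite (measurableSet_lt hd (measurable_alloc_sum hx))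
    ((hd.div (measurable_alloc_sum hx)).smul hx) hx

theorem measurable_loss (l : V → ℝ) {y : Θ → ∀ k, Alloc Gr k}
    (hy : ∀ k, Measurable fun θ => y θ k) (i : V) : Measurable fun θ => loss l (y θ) i := by
  have htransfer : ∀ k j, Measurable fun θ => transfer (y θ) k j := by
    intro k j
    unfold transfer
    split_ifs with h
    · exact measurable_alloc_apply (hy k) _
    · exact measurable_const
  have hsatisfaction : ∀ j, Measurable fun θ => satisfaction l (y θ) j := fun j =>
    ((Finset.measurable_fun_sum _ fun k _ => htransfer k j).div_const _).min measurable_const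
  exact measurable_const.sub
    ((Finset.measurable_fun_sum _ fun j _ => hsatisfaction j).const_mul _)

end Allocations

variable {net : Network V}

/-- The canonical sample space of the randomness of a run: the directions, indexed by node and
round, together with the generations and the starting points. -/
abbrev Sample (net : Network V) : Type _ :=
  (∀ a : V × ℕ, Metric.sphere (0 : Alloc net.graph a.1) 1) ×
    ((V × ℕ → ℝ) × ∀ k, Alloc net.graph k)

/-- The run on a point of the sample space. -/
noncomputable def Sample.input (c : Sample net) (T : ℕ) (ε p : V → ℝ) : RunInput net where
  T := T
  ε := ε
  p := p
  gen k t := c.2.1 (k, t)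
  dir k t := c.1 (k, t)
  start := c.2.2

/-- Measurability of all components of random memories. -/
structure MeasurableState (s : Sample net → ∀ k, AgentState (Alloc net.graph k)) : Prop where
  expert : ∀ k m, Measurable fun c => (s c k).expert m
  weight : ∀ k m, Measurable fun c => (s c k).weight m
  dual : ∀ k, Measurable fun c => (s c k).dual

variable (S : Scenario net) (T : ℕ) (ε p : V → ℝ)

theorem measurable_gen (k : V) (t : ℕ) :
    Measurable fun c : Sample net => (c.input T ε p).gen k t :=
  (measurable_pi_apply (k, t)).comp (measurable_fst.comp measurable_snd)

theorem measurable_dir (k : V) (t : ℕ) :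
    Measurable fun c : Sample net => (c.input T ε p).dir k t :=
  ((measurable_pi_apply (k, t)).comp measurable_fst).subtype_val

theorem measurable_start (k : V) : Measurable fun c : Sample net => (c.input T ε p).start k :=
  (measurable_pi_apply k).comp (measurable_snd.comp measurable_snd)

namespace MeasurableState

variable {S T ε p} {s : Sample net → ∀ k, AgentState (Alloc net.graph k)}
  (hs : MeasurableState s)

include hs

theorem combine (k : V) : Measurable fun c => combine (c.input T ε p) k (s c k) :=
  Finset.measurable_fun_sum (Finset.Icc 1 (numExperts T)) fun m _ =>
    (hs.weight k m).smul (hs.expert k m)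

theorem perturb (k : V) (t : ℕ) : Measurable fun c => perturb (c.input T ε p) t k (s c k) :=
  (hs.combine k).add ((measurable_dir T ε p k t).const_smul (net.delta k (p k) t))

theorem lossFn (k : V) (t : ℕ) {x : Sample net → Alloc net.graph k} (hx : Measurable x) :
    Measurable fun c => lossFn S (c.input T ε p) t (s c) k (x c) := by
  classical
  refine measurable_loss _ (fun j => ?_) k
  by_cases hj : j = k
  · subst hj
    simpa using hx
  · simp only [Function.update_of_ne hj]
    exact measurable_adjust (hs.perturb j t) (measurable_gen T ε p j t)

theorem gradEst (k : V) (t : ℕ) :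
    Measurable fun c => gradEst S (c.input T ε p) t (s c) k :=
  ((hs.lossFn k t (hs.perturb k t)).const_mul
    (net.dim k / net.delta k (p k) t)).smul (measurable_dir T ε p k t)

theorem nextDual (k : V) (t : ℕ) :
    Measurable fun c => nextDual (c.input T ε p) t (s c) k :=
  measurable_const.max ((hs.dual k).add (((measurable_constr
    (measurable_adjust (hs.perturb k t) (measurable_gen T ε p k t))
    (measurable_gen T ε p k t)).sub ((hs.dual k).const_mul _)).const_mul _))

theorem updateDir (k : V) (t : ℕ) :
    Measurable fun c => updateDir S (c.input T ε p) t (s c) k :=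
  (((hs.lossFn k t (hs.perturb k t)).smul (measurable_dir T ε p k t)).add
    (((hs.nextDual k t).mul (measurable_constr (hs.perturb k t) (measurable_gen T ε p k t))).smul
      (measurable_dir T ε p k t))).const_smul (net.dim k / net.delta k (p k) t)

theorem nextState (t : ℕ) :
    MeasurableState fun c => nextState S (c.input T ε p) t (s c) := by
  have hweight : ∀ k m, Measurable fun c => (s c k).weight m *
      Real.exp (-ε k * surrogate S (c.input T ε p) t (s c) k ((s c k).expert m)) :=
    fun k m => (hs.weight k m).mul (Real.measurable_exp.comp
      (((hs.gradEst k t).inner ((hs.expert k m).sub (hs.combine k))).const_mul _))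
  refine ⟨fun k m => ?_, fun k m => ?_, fun k => hs.nextDual k t⟩
  · exact (continuous_proj (S.action_nonempty k).smul_set (S.smul_action_isClosed _)
      ((S.action_convex k).smul (1 - net.xi k (p k) (t + 1)))).measurable.comp
        ((hs.expert k m).sub ((hs.updateDir k t).const_smul (net.eta k m (t + 1))))
  · exact (hweight k m).div (Finset.measurable_fun_sum (Finset.Icc 1 (numExperts T))
      fun m' _ => hweight k m')

end MeasurableState

theorem measurableState_state (t : ℕ) :
    MeasurableState fun c => state S (c.input T ε p) t := by
  have hfirst : MeasurableState fun c : Sample net => firstState (c.input T ε p) :=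
    ⟨fun k _ => measurable_start T ε p k,
      fun _ m => (measurable_const : Measurable fun _ => priorWeight (numExperts T) m),
      fun _ => (measurable_const : Measurable fun _ => (0 : ℝ))⟩
  match t with
  | 0 => exact hfirst
  | 1 => exact hfirst
  | t + 2 => exact (measurableState_state (t + 1)).nextState (t + 1)

theorem measurable_roundLoss (k : V) (t : ℕ) {x : Sample net → Alloc net.graph k}
    (hx : Measurable x) : Measurable fun c => roundLoss S (c.input T ε p) k t (x c) :=
  (measurableState_state S T ε p t).lossFn k t hx

theorem measurable_decision (k : V) (t : ℕ) :
    Measurable fun c : Sample net => decision S (c.input T ε p) k t :=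
  (measurableState_state S T ε p t).perturb k t

theorem measurable_subgradientGap (k : V) (v : ℕ → Alloc net.graph k) (t : ℕ) :
    Measurable fun c : Sample net => subgradientGap S (c.input T ε p) k v t := by
  have hs := measurableState_state S T ε p t
  have hshrunk : Measurable fun c : Sample net => shrunk (c.input T ε p) k v t :=
    (measurable_const : Measurable fun _ => (1 - net.xi k (p k) (t + 1)) • v t)
  exact ((measurable_roundLoss S T ε p k t (hs.combine k)).sub
    (measurable_roundLoss S T ε p k t hshrunk)).sub
    ((hs.gradEst k t).inner ((hs.combine k).sub hshrunk))

end Measurability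

/-! ### The expected regret -/

section Locality

variable {V : Type*} [Fintype V] {net : Network V} (S : Scenario net) (I : RunInput net)

theorem nextState_congr_dir {dir : ∀ k, ℕ → Alloc net.graph k} {t : ℕ}
    (h : ∀ k, dir k t = I.dir k t) (s : ∀ k, AgentState (Alloc net.graph k)) :
    nextState S { I with dir := dir } t s = nextState S I t s := by
  have hperturb : ∀ k x, perturb { I with dir := dir } t k x = perturb I t k x := fun k x => by
    simp only [perturb, h k]
    rfl
  have hloss : ∀ k x, lossFn S { I with dir := dir } t s k x = lossFn S I t s k x := fun k x => by
    simp only [lossFn, hperturb]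
  have hgrad : ∀ k, gradEst S { I with dir := dir } t s k = gradEst S I t s k := fun k => by
    simp only [gradEst, hperturb, hloss, h k]
  have hdual : ∀ k, nextDual { I with dir := dir } t s k = nextDual I t s k := fun k => by
    simp only [nextDual, hperturb]
  have hdirection : ∀ k, updateDir S { I with dir := dir } t s k = updateDir S I t s k :=
    fun k => by simp only [updateDir, hperturb, hloss, hdual, h k]
  have hsurrogate : ∀ k x,
      surrogate S { I with dir := dir } t s k x = surrogate S I t s k x := fun k x => by
    simp only [surrogate, hgrad]
    rfl
  funext k
  simp only [nextState, hdirection, hsurrogate, hdual]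

theorem state_congr_dir {dir : ∀ k, ℕ → Alloc net.graph k} {t : ℕ}
    (h : ∀ k, ∀ r < t, dir k r = I.dir k r) :
    state S { I with dir := dir } t = state S I t :=
  match t with
  | 0 => rfl
  | 1 => rfl
  | t + 2 => by
    rw [state_succ S _ (by omega), state_succ S I (by omega),
      state_congr_dir fun k r hr => h k r (by omega),
      nextState_congr_dir S I fun k => h k (t + 1) (by omega)]

/-- The direction of node `k` in round `t` enters the gap of this round only through the gradient
estimate of `k`: the other nodes have committed to their decisions. -/
theorem subgradientGap_congr_dir {dir : ∀ k, ℕ → Alloc net.graph k} {k : V} {t : ℕ}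
    (hpast : ∀ j, ∀ r < t, dir j r = I.dir j r) (hother : ∀ j ≠ k, dir j t = I.dir j t)
    (v : ℕ → Alloc net.graph k) :
    subgradientGap S { I with dir := dir } k v t =
      roundLoss S I k t (combine I k (state S I t k)) - roundLoss S I k t (shrunk I k v t) -
      inner ℝ ((net.dim k / net.delta k (I.p k) t * roundLoss S I k t
        (combine I k (state S I t k) + net.delta k (I.p k) t • dir k t)) • dir k t)
        (combine I k (state S I t k) - shrunk I k v t) := by
  classical
  have hstate := state_congr_dir S I hpast
  have hloss : ∀ x, lossFn S { I with dir := dir } t (state S I t) k x =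
      lossFn S I t (state S I t) k x := by
    intro x
    unfold lossFn
    congr 1
    funext j
    by_cases hj : j = k
    · subst hj; simp
    · rw [Function.update_of_ne hj, Function.update_of_ne hj]
      simp only [perturb, hother j hj]
      rfl
  simp only [subgradientGap, roundLoss, gradEst, hstate, hloss]
  rfl

end Locality

section Expectation

variable {V : Type*} [Fintype V]

theorem sphereInvariant_sphereUniform (Gr : SimpleGraph V) (k : V) :
    SphereInvariant (sphereUniform Gr k) := by
  intro e
  rw [sphereUniform, Measure.map_smul, sphereInvariant_toSphere e]

instance isProbabilityMeasure_sphereUniform (Gr : SimpleGraph V) (k : V) :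
    IsProbabilityMeasure (sphereUniform Gr k) := by
  have : Nonempty (closedNbhd Gr k) := ⟨k, mem_closedNbhd.mpr (Or.inl rfl)⟩
  have : NeZero (volume : Measure (Alloc Gr k)).toSphere := ⟨Measure.toSphere_ne_zero _⟩
  exact isProbabilityMeasureSMul

variable {net : Network V} {S : Scenario net} {T : ℕ} {ε p : V → ℝ} {k : V}
  {v : ℕ → Alloc net.graph k} {t : ℕ}

theorem integral_subgradientGap_update_le [DecidableEq V] {c : Sample net}
    (hδ : 0 < net.delta k (p k) t) :
    ∫ x, subgradientGap S (Sample.input (Function.update c.1 (k, t) x, c.2) T ε p) k v t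
        ∂(sphereUniform net.graph k) ≤ 2 * net.lip * net.delta k (p k) t := by
  set I := c.input T ε p
  have hgap := fun x : Metric.sphere (0 : Alloc net.graph k) 1 =>
    subgradientGap_congr_dir S I
      (dir := fun j r => (Function.update c.1 (k, t) x (j, r) : Alloc net.graph j))
      (t := t) (fun j r hr => by rw [Function.update_of_ne (by simp [hr.ne])]; rfl)
      (fun j hj => by rw [Function.update_of_ne (by simp [hj])]; rfl) v
  simp only [Function.update_self] at hgap
  refine (integral_congr_ae (.of_forall hgap)).trans_le ?_
  exact integral_loss_one_point_estimate_le (sphereInvariant_sphereUniform net.graph k)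
    net.minDemand_pos (fun j => S.demand_ge j t) _ (fun x => rfl) hδ _ _

theorem Admissible.abs_subgradientGap_le {I : RunInput net} (hI : Admissible S I)
    (hk : (nbhd net.graph k).Nonempty) (ht : t ∈ Finset.Icc 1 I.T) (hv : v t ∈ S.action k) :
    |subgradientGap S I k v t| ≤ 2 * (net.lossBound * (fourthRoot I.T / fourthRoot t)) +
      net.gradBound k * fourthRoot I.T *
        (2 * (net.reach k * (fourthRoot I.T / fourthRoot t))) := by
  have hz := hI.norm_le_of_mem_shrunk ht (hI.combine_mem (Finset.mem_Icc.mp ht).1 k)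
  have hw := hI.norm_shrunk_le ht hv
  have hinner : |inner ℝ (gradEst S I t (state S I t) k)
      (combine I k (state S I t k) - shrunk I k v t)| ≤ net.gradBound k * fourthRoot I.T *
        (2 * (net.reach k * (fourthRoot I.T / fourthRoot t))) :=
    (abs_real_inner_le_norm _ _).trans (mul_le_mul (hI.norm_gradEst_le ht hk)
      ((norm_sub_le _ _).trans (by linarith)) (norm_nonneg _)
      (mul_nonneg (net.gradBound_pos hk).le (fourthRoot_nonneg _)))
  refine (abs_sub _ _).trans (add_le_add ((abs_sub _ _).trans ?_) hinner)
  linarith [hI.abs_roundLoss_le ht hz, hI.abs_roundLoss_le ht hw]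

theorem Admissible.norm_le_of_mem_action {I : RunInput net} (hI : Admissible S I)
    (ht : t ∈ Finset.Icc 1 I.T) {x : Alloc net.graph k} (hx : x ∈ S.action k) :
    ‖x‖ ≤ net.reach k * (fourthRoot I.T / fourthRoot t) :=
  (le_add_of_nonneg_right (hI.delta_nonneg k t)).trans
    (hI.norm_add_delta_le ht (a := 1) (by simpa using hI.xi_nonneg k t) (by rwa [one_smul]))

variable {Ω : Type*} [MeasurableSpace Ω] {P : Measure Ω} [IsProbabilityMeasure P]

section Integrable

variable {c : Ω → Sample net} (hc : Measurable c)
  (hI : ∀ ω, Admissible S ((c ω).input T ε p))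

include hc hI

theorem integrable_subgradientGap (hk : (nbhd net.graph k).Nonempty) (ht : t ∈ Finset.Icc 1 T)
    (hv : v t ∈ S.action k) :
    Integrable (fun ω => subgradientGap S ((c ω).input T ε p) k v t) P :=
  .of_bound ((measurable_subgradientGap S T ε p k v t).comp hc).aestronglyMeasurable
    (2 * (net.lossBound * (fourthRoot T / fourthRoot t)) + net.gradBound k * fourthRoot T *
      (2 * (net.reach k * (fourthRoot T / fourthRoot t))))
    (.of_forall fun ω => (hI ω).abs_subgradientGap_le hk ht hv)

theorem integrable_roundLoss (ht : t ∈ Finset.Icc 1 T) {x : Sample net → Alloc net.graph k}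
    (hx : Measurable x)
    (hbound : ∀ ω, ‖x (c ω)‖ ≤ net.reach k * (fourthRoot T / fourthRoot t)) :
    Integrable (fun ω => roundLoss S ((c ω).input T ε p) k t (x (c ω))) P :=
  .of_bound ((measurable_roundLoss S T ε p k t hx).comp hc).aestronglyMeasurable
    (net.lossBound * (fourthRoot T / fourthRoot t))
    (.of_forall fun ω => (hI ω).abs_roundLoss_le ht (hbound ω))

theorem integrable_dynRegret (hv : ∀ t ∈ Finset.Icc 1 T, v t ∈ S.action k) :
    Integrable (fun ω => dynRegret S ((c ω).input T ε p) k v) P := by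
  have hplayed : ∀ t ∈ Finset.Icc 1 T, Integrable (fun ω => roundLoss S ((c ω).input T ε p) k t
      (decision S ((c ω).input T ε p) k t)) P := fun t ht =>
    integrable_roundLoss (x := fun c => decision S (c.input T ε p) k t) hc hI ht
      (measurable_decision S T ε p k t) fun ω => (hI ω).norm_decision_le ht k
  have hcomparator : ∀ t ∈ Finset.Icc 1 T,
      Integrable (fun ω => roundLoss S ((c ω).input T ε p) k t (v t)) P := fun t ht =>
    integrable_roundLoss (x := fun _ => v t) hc hI ht measurable_const
      fun ω => (hI ω).norm_le_of_mem_action ht (hv t ht)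
  exact (integrable_finsetSum _ hplayed).sub (integrable_finsetSum _ hcomparator)

end Integrable

/-- The constant in the bound of the expected dynamic regret. -/
noncomputable def Network.regretConst (net : Network V) (k : V) : ℝ :=
  net.lip * (3 + net.actionBound k / net.r k) * (4 * net.deltaCoeff k 1) + net.trackingConst k

section Randomness

variable {U : ∀ a : V × ℕ, Ω → Metric.sphere (0 : Alloc net.graph a.1) 1}
  {Z : Ω → (V × ℕ → ℝ) × ∀ k, Alloc net.graph k} (hU : ∀ a, Measurable (U a))
  (hlaw : ∀ t, P.map (U (k, t)) = sphereUniform net.graph k) (hind : iIndepFun U P)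
  (hZ : Measurable Z) (hUZ : IndepFun (fun ω a => U a ω) Z P)
  (hI : ∀ ω, Admissible S (Sample.input (fun a => U a ω, Z ω) T ε p))
  (hk : (nbhd net.graph k).Nonempty)

include hU hlaw hind hZ hUZ hI hk

theorem integral_subgradientGap_le (ht : t ∈ Finset.Icc 1 T) (hv : v t ∈ S.action k) :
    ∫ ω, subgradientGap S (Sample.input (fun a => U a ω, Z ω) T ε p) k v t ∂P ≤
      2 * net.lip * net.delta k (p k) t := by
  classical
  obtain ⟨ω₀⟩ := P.nonempty_of_neZero
  refine integral_le_of_forall_integral_update_le hU hZ hind hUZ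
    (measurable_subgradientGap S T ε p k v t)
    (integrable_subgradientGap ((measurable_pi_lambda _ hU).prodMk hZ) hI hk ht hv) (k, t)
    fun ω => ?_
  rw [hlaw t]
  exact integral_subgradientGap_update_le (c := (fun a => U a ω, Z ω))
    ((hI ω₀).delta_pos hk (Finset.mem_Icc.mp ht).1)

theorem integral_dynRegret_le (hv : ∀ t ∈ Finset.Icc 1 T, v t ∈ S.action k)
    (hε : ε k = 1 / fourthRoot T ^ 3) (hp : p k ≤ pathLength T v) :
    ∫ ω, dynRegret S (Sample.input (fun a => U a ω, Z ω) T ε p) k v ∂P ≤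
      net.regretConst k * ((1 + Real.log T) * (fourthRoot T ^ 3 * √(1 + pathLength T v))) := by
  obtain ⟨ω₀⟩ := P.nonempty_of_neZero
  have hc : Measurable fun ω => ((fun a => U a ω, Z ω) : Sample net) :=
    (measurable_pi_lambda _ hU).prodMk hZ
  set rate := (1 + Real.log T) * (fourthRoot T ^ 3 * √(1 + pathLength T v))
  set bias := net.lip * (1 + net.actionBound k / net.r k) *
    ∑ t ∈ Finset.Icc 1 T, net.delta k (p k) t + net.trackingConst k * rate with hbias
  have hgap : ∀ t ∈ Finset.Icc 1 T, Integrable (fun ω =>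
      subgradientGap S (Sample.input (fun a => U a ω, Z ω) T ε p) k v t) P :=
    fun t ht => integrable_subgradientGap hc hI hk ht (hv t ht)
  have hdelta : ∑ t ∈ Finset.Icc 1 T, net.delta k (p k) t ≤
      4 * net.deltaCoeff k 1 * rate := by
    have hscale : fourthRoot T ^ 3 * √(1 + pathLength T v) ≤ rate :=
      le_mul_of_one_le_left (mul_nonneg (pow_nonneg (fourthRoot_nonneg T) 3) (Real.sqrt_nonneg _))
        (le_add_of_nonneg_right (Real.log_natCast_nonneg T))
    exact ((hI ω₀).sum_delta_le hp).trans (mul_le_mul_of_nonneg_left hscale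
      (mul_nonneg zero_le_four (net.deltaCoeff_nonneg k zero_le_one)))
  have hcoeff : 0 ≤ net.lip * (3 + net.actionBound k / net.r k) :=
    mul_nonneg net.lip_pos.le
      (add_nonneg zero_le_three (div_pos (net.actionBound_pos k) (net.r_pos k)).le)
  calc ∫ ω, dynRegret S (Sample.input (fun a => U a ω, Z ω) T ε p) k v ∂P
    _ ≤ ∫ ω, (∑ t ∈ Finset.Icc 1 T,
          subgradientGap S (Sample.input (fun a => U a ω, Z ω) T ε p) k v t + bias) ∂P :=
        integral_mono (integrable_dynRegret hc hI hv)
          ((integrable_finsetSum _ hgap).add (integrable_const _))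
          fun ω => (hI ω).dynRegret_le hk hv hε
    _ = ∑ t ∈ Finset.Icc 1 T, ∫ ω,
          subgradientGap S (Sample.input (fun a => U a ω, Z ω) T ε p) k v t ∂P + bias := by
        rw [integral_add (integrable_finsetSum _ hgap) (integrable_const _),
          integral_finsetSum _ hgap, integral_const, probReal_univ, one_smul]
    _ ≤ ∑ t ∈ Finset.Icc 1 T, 2 * net.lip * net.delta k (p k) t + bias := by
        gcongr with t ht
        exact integral_subgradientGap_le hU hlaw hind hZ hUZ hI hk ht (hv t ht)
    _ = net.lip * (3 + net.actionBound k / net.r k) * ∑ t ∈ Finset.Icc 1 T, net.delta k (p k) t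
          + net.trackingConst k * rate := by
        rw [← Finset.mul_sum, hbias]
        ring
    _ ≤ net.regretConst k * rate := by
        unfold Network.regretConst
        linarith [mul_le_mul_of_nonneg_left hdelta hcoeff]

end Randomness

end Expectation

end ResourceSharing

open MeasureTheory ProbabilityTheory ResourceSharing in
theorem mainTheorem2_general {V : Type*} [Fintype V] (net : Network V) (i : V)
    (hi : (nbhd net.graph i).Nonempty) (S : Scenario net) {T : ℕ} (hT : 1 ≤ T) {ε p : V → ℝ}
    (hε : ε i = (T : ℝ) ^ (-(3 / 4) : ℝ)) (hp : ∀ k, 0 ≤ p k ∧ p k ≤ 2 * net.R k * T)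
    {v : ℕ → Alloc net.graph i} (hv : ∀ t ∈ Finset.Icc 1 T, v t ∈ S.action i)
    (hpi : p i ≤ pathLength T v) {Ω : Type*} [MeasurableSpace Ω] {P : Measure Ω}
    [IsProbabilityMeasure P] {d : V → ℕ → Ω → ℝ}
    {U : ∀ k, ℕ → Ω → Metric.sphere (0 : Alloc net.graph k) 1}
    {z₁ : ∀ k, Ω → Alloc net.graph k} (hd : ∀ k t, Measurable (d k t))
    (hd0 : ∀ k t ω, 0 ≤ d k t ω) (hz : ∀ k, Measurable (z₁ k))
    (hz₁ : ∀ k ω, z₁ k ω ∈ (1 - net.xi k (p k) 1) • S.action k)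
    (hU : ∀ k t, Measurable (U k t)) (hlaw : ∀ t, P.map (U i t) = sphereUniform net.graph i)
    (hind : iIndepFun (fun (a : V × ℕ) ω => U a.1 a.2 ω) P)
    (hindep : IndepFun (fun ω (a : V × ℕ) => U a.1 a.2 ω)
      (fun ω => ((fun (a : V × ℕ) => d a.1 a.2 ω), fun k => z₁ k ω)) P) :
    let regret : Ω → ℝ := fun ω => dynRegret S
      { T := T, ε := ε, p := p, gen := fun k t => d k t ω,
        dir := fun k t => (U k t ω : Alloc net.graph k), start := fun k => z₁ k ω } i v
    Integrable regret P ∧ ∫ ω, regret ω ∂P ≤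
      net.regretConst i * (1 + Real.log T) *
        ((T : ℝ) ^ (3 / 4 : ℝ) * (1 + pathLength T v) ^ (1 / 2 : ℝ)) := by
  intro regret
  let c : Ω → Sample net := fun ω =>
    (fun a => U a.1 a.2 ω, fun a => d a.1 a.2 ω, fun k => z₁ k ω)
  have hU' : ∀ a : V × ℕ, Measurable (U a.1 a.2) := fun a => hU a.1 a.2
  have hZ : Measurable fun ω => (c ω).2 :=
    (measurable_pi_lambda _ fun a : V × ℕ => hd a.1 a.2).prodMk (measurable_pi_lambda _ hz)
  have hI : ∀ ω, Admissible S ((c ω).input T ε p) := fun ω =>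
    { one_le_horizon := hT
      p_nonneg := fun k => (hp k).1
      p_le := fun k => (hp k).2
      gen_nonneg := fun k t => hd0 k t ω
      norm_dir := fun k t => norm_eq_of_mem_sphere (U k t ω)
      start_mem := fun k => hz₁ k ω }
  have hint : Integrable (fun ω => dynRegret S ((c ω).input T ε p) i v) P :=
    integrable_dynRegret ((measurable_pi_lambda _ hU').prodMk hZ) hI hv
  rw [rpow_neg_three_quarters] at hε
  rw [rpow_three_quarters, ← Real.sqrt_eq_rpow, mul_assoc]
  exact ⟨hint, integral_dynRegret_le (U := fun a => U a.1 a.2) (Z := fun ω => (c ω).2)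
    hU' hlaw hind hZ hindep hI hi hv hε hpi⟩

theorem mainTheorem2 {V : Type*} [Fintype V] (net : ResourceSharing.Network V) (i : V)
    (hi : (ResourceSharing.nbhd net.graph i).Nonempty) :
    ∃ (C : ℝ) (a : ℕ) (ε₀ : ℕ → ℝ), (∀ T, 1 ≤ T → 0 < ε₀ T) ∧
      ∀ (S : ResourceSharing.Scenario net) (T : ℕ), 1 ≤ T →
      ∀ (ε p : V → ℝ) (v : ∀ k, ℕ → ResourceSharing.Alloc net.graph k),
        ε i = ε₀ T →
        (∀ k, ∀ t ∈ Finset.Icc 1 T, v k t ∈ S.action k) →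
        (∀ k, 0 ≤ p k ∧ p k ≤ ResourceSharing.pathLength T (v k)) →
      ∀ (Ω : Type*) [MeasurableSpace Ω] (P : MeasureTheory.Measure Ω)
        [MeasureTheory.IsProbabilityMeasure P]
        (d : V → ℕ → Ω → ℝ)
        (U : ∀ k, ℕ → Ω → Metric.sphere (0 : ResourceSharing.Alloc net.graph k) 1)
        (z₁ : ∀ k, Ω → ResourceSharing.Alloc net.graph k),
        (∀ k t, Measurable (d k t)) →
        (∀ k t ω, 0 ≤ d k t ω) →
        (∀ k t ω, ∀ x ∈ S.action k, |ResourceSharing.constr x (d k t ω)| ≤ net.G k) →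
        (∀ k, Measurable (z₁ k)) →
        (∀ k ω, z₁ k ω ∈ (1 - net.xi k (p k) 1) • S.action k) →
        (∀ k t, Measurable (U k t)) →
        (∀ k t, P.map (U k t) = ResourceSharing.sphereUniform net.graph k) →
        ProbabilityTheory.iIndepFun (fun (a : V × ℕ) ω => U a.1 a.2 ω) P →
        ProbabilityTheory.IndepFun (fun ω (a : V × ℕ) => U a.1 a.2 ω)
          (fun ω => ((fun (a : V × ℕ) => d a.1 a.2 ω), (fun k => z₁ k ω))) P →
        let regret : Ω → ℝ := fun ω =>
          ResourceSharing.dynRegret S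
            { T := T, ε := ε, p := p, gen := fun k t => d k t ω,
              dir := fun k t => (U k t ω : ResourceSharing.Alloc net.graph k),
              start := fun k => z₁ k ω } i (v i)
        MeasureTheory.Integrable regret P ∧
        ∫ ω, regret ω ∂P ≤ C * (1 + Real.log T) ^ a *
          ((T : ℝ) ^ (3 / 4 : ℝ) *
            (1 + ResourceSharing.pathLength T (v i)) ^ (1 / 2 : ℝ)) := by
  refine ⟨net.regretConst i, 1, fun T => (T : ℝ) ^ (-(3 / 4) : ℝ),
    fun T hT => Real.rpow_pos_of_pos (Nat.cast_pos.mpr hT) _, ?_⟩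
  intro S T hT ε p v hε hv hp Ω _ P _ d U z₁ hd hd0 _ hz hz₁ hU hlaw hind hindep
  rw [pow_one]
  exact mainTheorem2_general net i hi S hT hε
    (fun k => ⟨(hp k).1, (hp k).2.trans (S.pathLength_le (hv k))⟩) (hv i) (hp i).2 hd hd0 hz hz₁
    hU (hlaw i) hind hindep
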